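/- **Setting.** Let $d,m,n,k\ge 1$, let $\mathbb S^d$ be the unit sphere of $\mathbb R^d$, let $\mathsf D$ be a probability distribution on a data space $\Gamma$, let $f:\mathbb R^d\times\Gamma\to\mathbb R$ be a loss with $f(w;\cdot)$ integrable for every $w$, and let $F(w)=\mathbb E_{\gamma\sim\mathsf D}[f(w;\gamma)]$. Let $\mathcal W\subseteq\mathbb R^d$ be convex and compact with diameter $D$. There are $m$ clients; client $i$ holds $n$ samples $\gamma^{i,1},\dots,\gamma^{i,n}$, all $nm$ samples being i.i.d. from $\mathsf D$. A fixed set $\mathcal B$ of $\alpha m$ clients is Byzantine. For $w\in\mathbb R^d$ and $z\in\mathbb S^d$, the zero-order estimate with $\mu=0$ (projected gradient) is $\mathbf g(w,z,\gamma)=g(w,z,\gamma)\,z$ with $g(w,z,\gamma)=d\langle\nabla f(w;\gamma),z\rangle$. Put $\bar{\mathbf g}(w,z)=\mathbb E_{\gamma\sim\mathsf D}[\mathbf g(w,z,\gamma)]$. An honest client $i$ sends $g_i(w,z)=\frac1n\sum_{j}g(w,z,\gamma^{i,j})$; Byzantine clients send arbitrary real numbers. The federator forms $\hat g_\beta(w,z)$,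 the $\beta$-trimmed mean of the $m$ received numbers: it discards the $\lfloor\beta m\rfloor$ largest and the $\lfloor\beta m\rfloor$ smallest and averages the others. **Algorithm (projected CyBeR-0).** Let $w^0\in\mathcal W$. At step $t$ draw $Z^t=\{z_1^t,\dots,z_k^t\}$ independently and uniformly from $\mathbb S^d$, independently of the data and of the past, and set $$w^{t+1}=\Pi_{\mathcal W}\Big(w^t-\eta\,\tfrac1k\sum_{r=1}^k\hat g_\beta(w^t,z_r^t)\,z_r^t\Big),$$ where $\Pi_{\mathcal W}$ is the Euclidean projection. The Byzantine messages of step $t$ may depend arbitrarily (measurably) on the data and on $Z^0,\dots,Z^t$. Let $\mathbb E_{\mathcal Z}$ be the expectation over all directions, with the data fixed. **Assumptions.** (1) For every $\gamma$, $f(\cdot;\gamma)$ is $L$-smooth on $\mathbb R^d$; $F$ is $L_F$-smooth on $\mathbb R^d$; for every $\gamma$, $g(\cdot,z,\gamma)$ is $L_w$-Lipschitz on $\mathcal W$ for every $z\in\mathbb S^d$, and $g(w,\cdot,\gamma)$ is $L_z$-Lipschitz on $\mathbb S^d$ for every $w\in\mathcal W$. Put $\hat L=L_w+L_z$. (2)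 For some $v>0$ and all $w\in\mathcal W$, $z\in\mathbb S^d$, the variable $Y=g(w,z,\gamma)$, $\gamma\sim\mathsf D$, is $v$-sub-exponential: $\mathbb E[e^{s(Y-\mathbb EY)}]\le e^{v^2s^2/2}$ for $|s|<1/v$. (3) $F$ is $\lambda$-strongly convex on $\mathbb R^d$, $\lambda>0$. (4) $w^*\in\mathcal W$ minimizes $F$ over $\mathcal W$ and is a local minimum of $F$ on $\mathbb R^d$. (5) $\epsilon>0$ and $\alpha\le\beta<\frac12-\epsilon$. **Theorem (Convergence, $\mu=0$).** There is an absolute constant $C>0$ such that the following holds in every such setting. Put $\tau=\frac{d+k-1}{k}$, $\eta=\frac1{\tau L_F}$, $\Lambda=\log(1+nm\hat LD)+\log(1+2nm\hat L)$ and $$\Delta=\sqrt{\Lambda+\tfrac1d\log m}\;\frac{v\sqrt d}{\epsilon}\Big(\frac{3\beta}{\sqrt n}+\frac{\sqrt2}{\sqrt{nm}}\Big)+\frac C\epsilon\big(1+v(d\Lambda+\log m)\big)\Big(\frac\beta n+\frac1{mn}\Big).$$ The second summand is $\tilde O\big(\frac\beta n+\frac1{mn}\big)$. With probability at least $1-\frac{4}{(1+2nm\hat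 L)^d(1+nm\hat LD)^d}$ over the data, both of the following hold: (a) (robustness) for all $w\in\mathcal W$, all $z_1,\dots,z_k\in\mathbb S^d$ and all Byzantine messages, $\big\|\frac1k\sum_r\hat g_\beta(w,z_r)z_r-\frac1k\sum_r\bar{\mathbf g}(w,z_r)\big\|_2\le\Delta$; (b) (convergence) for every Byzantine strategy, every $w^0\in\mathcal W$ and every $T\ge0$, $\|w^T-w^*\|_2$ is integrable and $$\mathbb E_{\mathcal Z}\big[\|w^T-w^*\|_2\big]\le\Big(1-\frac{\lambda}{\tau(L_F+\lambda)}\Big)^T\|w^0-w^*\|_2+\frac2\lambda\Delta .$$ -/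

import Mathlib

open MeasureTheory ProbabilityTheory
open scoped NNReal

namespace CyBeR0

noncomputable section

/-- Model parameters: `ℝ^d` with the Euclidean norm. -/
abbrev Vec (d : ℕ) : Type := EuclideanSpace ℝ (Fin d)

/-- The set of unit-norm vectors of `ℝ^d`. -/
abbrev UnitSphere (d : ℕ) : Type := Metric.sphere (0 : Vec d) 1

/-- The uniform probability distribution on the unit sphere: normalised surface measure. -/
def uniformSphere (d : ℕ) : Measure (UnitSphere d) :=
  ((volume : Measure (Vec d)).toSphere Set.univ)⁻¹ • (volume : Measure (Vec d)).toSphere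

theorem isProbabilityMeasure_uniformSphere {d : ℕ} (hd : 1 ≤ d) :
    IsProbabilityMeasure (uniformSphere d) := by
  have : NeZero d := ⟨by omega⟩
  have : Nontrivial (Vec d) := inferInstance
  have h0 : (volume : Measure (Vec d)).toSphere Set.univ ≠ 0 := by
    rw [Ne, Measure.measure_univ_eq_zero]
    exact Measure.toSphere_ne_zero _
  refine ⟨?_⟩
  rw [uniformSphere, Measure.smul_apply, smul_eq_mul]
  exact ENNReal.inv_mul_cancel h0 (measure_ne_top _ _)

/-- The law of the random directions: `ζ t r` is the direction with index `r` sampled at step `t`;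
all directions are independent and uniform on the unit sphere. -/
def directionLaw (d k : ℕ) : Measure (ℕ → Fin k → UnitSphere d) :=
  Measure.infinitePi fun _ => Measure.pi fun _ => uniformSphere d

/-- Euclidean projection on `W`: a point of `W` at minimal distance from `u`
(it exists and is unique if `W` is nonempty, closed and convex). -/
def euclProj {d : ℕ} (W : Set (Vec d)) (u : Vec d) : Vec d :=
  Classical.epsilon fun p => p ∈ W ∧ ∀ q ∈ W, ‖p - u‖ ≤ ‖q - u‖

/-- `h` is `L`-smooth: differentiable with `L`-Lipschitz gradient. -/
def IsLSmooth {d : ℕ} (L : ℝ≥0) (h : Vec d → ℝ) : Prop :=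
  Differentiable ℝ h ∧ LipschitzWith L (gradient h)

/-- `X` is `v`-sub-exponential under `ρ`:
`E[exp (s (X - E X))] ≤ exp (v² s² / 2)` for all `|s| < 1 / v`. -/
def IsSubExponential {Γ : Type*} [MeasurableSpace Γ] (v : ℝ) (X : Γ → ℝ) (ρ : Measure Γ) : Prop :=
  Integrable X ρ ∧ ∀ s : ℝ, |s| < 1 / v →
    Integrable (fun γ => Real.exp (s * (X γ - ∫ γ', X γ' ∂ρ))) ρ ∧
    ∫ γ, Real.exp (s * (X γ - ∫ γ', X γ' ∂ρ)) ∂ρ ≤ Real.exp (v ^ 2 * s ^ 2 / 2)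

/-- The scalar coefficient along `z` of the zero-order estimate of the gradient of `h` at `w` with
perturbation step `μ`: the number `a` such that the estimate is the vector `a • z`. -/
def zoCoeff {d : ℕ} (h : Vec d → ℝ) (μ : ℝ) (w z : Vec d) : ℝ :=
  if 0 < μ then d * ((h (w + μ • z) - h (w - μ • z)) / (2 * μ))
  else d * inner ℝ (gradient h w) z

/-- The single-sample zero-order estimate of the gradient of `h` at `w`. -/
def zoEstimate {d : ℕ} (h : Vec d → ℝ) (μ : ℝ) (w z : Vec d) : Vec d :=
  zoCoeff h μ w z • z

/-- The population loss `F w = E_γ[f(w; γ)]`. -/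
def populationLoss {d : ℕ} {Γ : Type*} [MeasurableSpace Γ] (f : Vec d → Γ → ℝ) (𝔻 : Measure Γ)
    (w : Vec d) : ℝ :=
  ∫ γ, f w γ ∂𝔻

/-- The zero-order population estimate `E_γ[g(w, z, γ)]`. -/
def populationEstimate {d : ℕ} {Γ : Type*} [MeasurableSpace Γ] (f : Vec d → Γ → ℝ)
    (𝔻 : Measure Γ) (μ : ℝ) (w z : Vec d) : Vec d :=
  ∫ γ, zoEstimate (fun u => f u γ) μ w z ∂𝔻

/-- The `β`-trimmed mean of `x₁, …, x_m`: sort the values, discard the `⌊β m⌋` smallest and the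
`⌊β m⌋` largest ones, and average the remaining `m - 2 ⌊β m⌋`. -/
def trimmedMean {m : ℕ} (β : ℝ) (x : Fin m → ℝ) : ℝ :=
  (∑ i : Fin m with ⌊β * m⌋₊ ≤ i.val ∧ i.val + ⌊β * m⌋₊ < m, x (Tuple.sort x i)) /
    ((m : ℝ) - 2 * ⌊β * m⌋₊)

/-- The value that an honest client with data samples `γ₁, …, γ_n` sends for direction `z`. -/
def clientCoeff {d n : ℕ} {Γ : Type*} (f : Vec d → Γ → ℝ) (μ : ℝ) (data : Fin n → Γ)
    (w z : Vec d) : ℝ :=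
  (1 / (n : ℝ)) * ∑ j, zoCoeff (fun u => f u (data j)) μ w z

/-- The values received by the federator for direction `z`: honest clients send `clientCoeff`, the
clients in `B` send the arbitrary values `byz`. -/
def messages {d m n : ℕ} {Γ : Type*} (f : Vec d → Γ → ℝ) (μ : ℝ) (B : Finset (Fin m))
    (data : Fin m → Fin n → Γ) (w z : Vec d) (byz : Fin m → ℝ) (i : Fin m) : ℝ :=
  if i ∈ B then byz i else clientCoeff f μ (data i) w z

/-- The federator's robust gradient estimate from the directions `z₁, …, z_k`. -/
def robustEstimate {d m n k : ℕ} {Γ : Type*} (f : Vec d → Γ → ℝ) (μ β : ℝ) (B : Finset (Fin m))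
    (data : Fin m → Fin n → Γ) (w : Vec d) (z : Fin k → UnitSphere d)
    (byz : Fin k → Fin m → ℝ) : Vec d :=
  (1 / (k : ℝ)) • ∑ r, trimmedMean β (messages f μ B data w (z r) (byz r)) • (z r : Vec d)

/-- A strategy of the Byzantine clients: the values sent at step `t` may depend in an arbitrary
way on everything that has happened so far, that is, on all directions sampled in steps `0, …, t`
(the data set is fixed when a strategy is chosen, so that it may depend on the data as well). -/
abbrev Attack (d k m : ℕ) : Type :=
  (t : ℕ) → (Fin (t + 1) → Fin k → UnitSphere d) → Fin k → Fin m → ℝ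

/-- The iterates `w^0, w^1, …` of the algorithm with constant step size `η`, for the data set
`data`, the Byzantine strategy `A` and the sampled directions `ζ`. -/
def iterate {d m n k : ℕ} {Γ : Type*} (f : Vec d → Γ → ℝ) (W : Set (Vec d)) (μ β η : ℝ)
    (B : Finset (Fin m)) (data : Fin m → Fin n → Γ) (A : Attack d k m) (w₀ : Vec d)
    (ζ : ℕ → Fin k → UnitSphere d) : ℕ → Vec d
  | 0 => w₀
  | t + 1 =>
    let w := iterate f W μ β η B data A w₀ ζ t
    euclProj W (w - η • robustEstimate f μ β B data w (ζ t) (A t fun s => ζ s))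

/-- The logarithmic factor `log (1 + n m L D) + log (1 + 2 n m L)`. -/
def logFactor (m n : ℕ) (L D : ℝ) : ℝ :=
  Real.log (1 + n * m * L * D) + Real.log (1 + 2 * n * m * L)

/-- The radius `Δ`. The second summand is the lower-order term, which is `Õ(β / n + 1 / (m n))`
with constant `C` and with its logarithmic factor written out. -/
def Delta (C : ℝ) (d m n : ℕ) (v ε β L D : ℝ) : ℝ :=
  √(logFactor m n L D + 1 / d * Real.log m) * (v * √d / ε) * (3 * β / √n + √2 / √(n * m)) +
    C / ε * (1 + v * (d * logFactor m n L D + Real.log m)) * (β / n + 1 / (m * n))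

end

end CyBeR0

open CyBeR0

/-!
The proof separates a statistical part, which holds with high probability over the data, from a
deterministic part about the algorithm.

**Robustness.** A trimmed mean is as close to a target `c` as the average of the honest values, up
to three times the trimmed fraction of the largest honest deviation (`abs_trimmedMean_sub_le`). It
therefore suffices to control, uniformly over `W × 𝕊`, the sum of the centred coefficients over the
samples of each client and over all honest samples. For fixed `(w, z)` this is Chernoff's bound
(`measureReal_abs_sum_ge_le`). Separated sets of maximal size provide nets of `W` and of the sphere
with at most `(1 + n m L D) ^ d` and `(1 + 2 n m L) ^ d` points (`exists_net`). A union bound over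
these points and the `m + 1` sums, with exponent `2 d Λ + log m`, gives the failure probability, and
the Lipschitz assumptions extend the estimate from the net (`exists_event_robust`). With the
exponent `A = 2 d Λ + log m`, the factor `1 / (1 - 2 β) ≤ 1 / (2 ε)` cancels the factor `2` in
`√(2 A) ≤ 2 √(d Λ + log m)`, so that the leading term has the constants claimed; the rest goes into
`C = 12` (`radius_le_Delta`).

**Convergence.** The population estimate in direction `z` is `d ⟪∇F w, z⟫ z`, by differentiation
under the integral sign (`integral_zoCoeff`). The uniform distribution on the sphere is invariant
under reflections, hence has covariance `1 / d` times the identity (`integral_inner_mul_inner`), and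
the average of `k` independent directions is an unbiased estimate of `∇F w` with second moment
`τ ‖∇F w‖ ^ 2` (`integral_norm_sq_batchEstimate`). With `η = 1 / (τ LF)`, the interpolation
inequality for smooth strongly convex functions (`IsLSmooth.interpolation`) absorbs the second
moment, and an exact step contracts the expected distance to `wStar` by
`1 - lam / (τ (LF + lam))` (`integral_norm_sub_batchEstimate_le`). The Euclidean projection does not
expand distances, and the directions of step `t` are independent of the current iterate
(`integral_directionLaw_step`), so every actual step contracts in the same way up to an additive
error `η Δ`. These errors sum to at most `2 Δ / lam` (`integral_norm_iterate_sub_le`).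
-/

namespace CyBeR0

/-! ### The trimmed mean -/

/-- If at most `⌊β m⌋` entries are corrupted, every entry that survives the trimming lies between
two uncorrupted ones. -/
theorem abs_sort_sub_le {m : ℕ} {b : ℕ} {B : Finset (Fin m)} (hB : B.card ≤ b) {x : Fin m → ℝ}
    {μ t : ℝ} (h : ∀ i ∉ B, |x i - μ| ≤ t) {p : Fin m} (hp : b ≤ p.val) (hp' : p.val + b < m) :
    |x (Tuple.sort x p) - μ| ≤ t := by
  have mono : Monotone (x ∘ Tuple.sort x) := Tuple.monotone_sort x
  have key : ∀ S : Finset (Fin m), b < S.card → ∃ q ∈ S, Tuple.sort x q ∉ B := by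
    intro S hS
    by_contra! hcon
    have : (S.map (Tuple.sort x).toEmbedding).card ≤ B.card := by
      apply Finset.card_le_card
      intro i hi
      obtain ⟨q, hq, rfl⟩ := Finset.mem_map.1 hi
      exact hcon q hq
    rw [Finset.card_map] at this
    omega
  obtain ⟨q, hq, hqB⟩ := key (Finset.Iic p) (by rw [Fin.card_Iic]; omega)
  obtain ⟨r, hr, hrB⟩ := key (Finset.Ici p) (by rw [Fin.card_Ici]; omega)
  have hqp : x (Tuple.sort x q) ≤ x (Tuple.sort x p) := mono (Finset.mem_Iic.1 hq)
  have hpr : x (Tuple.sort x p) ≤ x (Tuple.sort x r) := mono (Finset.mem_Ici.1 hr)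
  have h1 := abs_le.1 (h _ hqB)
  have h2 := abs_le.1 (h _ hrB)
  exact abs_le.2 ⟨by linarith, by linarith⟩

theorem card_kept {m b : ℕ} (hb : 2 * b ≤ m) :
    (Finset.univ.filter fun i : Fin m => b ≤ i.val ∧ i.val + b < m).card = m - 2 * b := by
  have : (Finset.univ.filter fun i : Fin m => b ≤ i.val ∧ i.val + b < m).card =
      (Finset.Ico b (m - b)).card := by
    apply Finset.card_bij (fun i _ => i.val)
    · intro i hi
      simp only [Finset.mem_filter, Finset.mem_univ, true_and] at hi
      exact Finset.mem_Ico.2 (by omega)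
    · intro i _ j _ hij
      exact Fin.ext hij
    · intro k hk
      have hk := Finset.mem_Ico.1 hk
      exact ⟨⟨k, by omega⟩, by simp only [Finset.mem_filter, Finset.mem_univ, true_and]; omega, rfl⟩
  rw [this, Nat.card_Ico]
  omega

/-- Robustness of the trimmed mean: it is as close to `μ` as the average of the uncorrupted entries
(`t₂`), up to three times the trimmed fraction of their largest deviation (`t₁`). The factor three
counts the uncorrupted entries that are trimmed (at most `2 ⌊β m⌋`) and the corrupted ones that are
kept (at most `⌊β m⌋`). -/
theorem abs_trimmedMean_sub_le {m : ℕ} (hm : 1 ≤ m) {β : ℝ} (hβ0 : 0 ≤ β) (hβ : β < 1 / 2)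
    {B : Finset (Fin m)} (hB : (B.card : ℝ) ≤ β * m) {x : Fin m → ℝ} {μ t₁ t₂ : ℝ}
    (h₁ : ∀ i ∉ B, |x i - μ| ≤ t₁) (h₂ : |∑ i ∈ Bᶜ, (x i - μ)| ≤ m * t₂) :
    |trimmedMean β x - μ| ≤ (t₂ + 3 * β * t₁) / (1 - 2 * β) := by
  have hm0 : (0 : ℝ) < m := by exact_mod_cast hm
  have hbm : (⌊β * m⌋₊ : ℝ) ≤ β * m := Nat.floor_le (by positivity)
  have hBb : B.card ≤ ⌊β * m⌋₊ := Nat.le_floor hB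
  rw [trimmedMean]
  set b := ⌊β * m⌋₊ with hb
  have h2b : 2 * b < m := by
    have : (2 * b : ℝ) < m := by nlinarith
    exact_mod_cast this
  set σ := Tuple.sort x
  set P := Finset.univ.filter fun i : Fin m => b ≤ i.val ∧ i.val + b < m with hP
  have hPc : P.card = m - 2 * b := card_kept (by omega)
  have hden : (0 : ℝ) < m - 2 * b := by
    have : ((2 * b : ℕ) : ℝ) < m := by exact_mod_cast h2b
    push_cast at this; linarith
  have hPc' : (P.card : ℝ) = m - 2 * b := by
    rw [hPc, Nat.cast_sub (by omega)]; push_cast; ring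
  have ht₁ : 0 ≤ t₁ := by
    obtain ⟨i, hi⟩ : ∃ i, i ∉ B := by
      by_contra! hcon
      have : B.card = m := by rw [Finset.eq_univ_of_forall hcon]; simp
      omega
    exact (abs_nonneg _).trans (h₁ i hi)
  have ht₂ : 0 ≤ t₂ := by
    have := (abs_nonneg _).trans h₂
    exact nonneg_of_mul_nonneg_right this hm0
  set K := P.map σ.toEmbedding with hK
  have hKc : K.card = m - 2 * b := by rw [hK, Finset.card_map, hPc]
  have hKbound : ∀ i ∈ K, |x i - μ| ≤ t₁ := by
    intro i hi
    obtain ⟨p, hp, rfl⟩ := Finset.mem_map.1 hi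
    simp only [hP, Finset.mem_filter, Finset.mem_univ, true_and] at hp
    exact abs_sort_sub_le hBb h₁ hp.1 hp.2
  have hsum : ∑ i ∈ P, x (σ i) = ∑ i ∈ K, x i := by rw [hK, Finset.sum_map]; rfl
  have hsub : (∑ i ∈ P, x (σ i)) / ((m : ℝ) - 2 * b) - μ =
      (∑ i ∈ K, (x i - μ)) / ((m : ℝ) - 2 * b) := by
    rw [hsum, Finset.sum_sub_distrib, Finset.sum_const, hK, Finset.card_map, nsmul_eq_mul, hPc']
    field_simp
  have hsplit : ∑ i ∈ K, (x i - μ) =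
      ∑ i ∈ Bᶜ, (x i - μ) - ∑ i ∈ Bᶜ \ K, (x i - μ) + ∑ i ∈ K \ Bᶜ, (x i - μ) := by
    have h1 := Finset.sum_inter_add_sum_sdiff K Bᶜ fun i => x i - μ
    have h2 := Finset.sum_inter_add_sum_sdiff Bᶜ K fun i => x i - μ
    rw [Finset.inter_comm] at h2
    linarith
  have hb1 : |∑ i ∈ Bᶜ \ K, (x i - μ)| ≤ 2 * b * t₁ := by
    refine (Finset.abs_sum_le_sum_abs _ _).trans ((Finset.sum_le_card_nsmul _ _ t₁ ?_).trans ?_)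
    · intro i hi
      exact h₁ i (Finset.mem_compl.1 (Finset.mem_sdiff.1 hi).1)
    · rw [nsmul_eq_mul]
      have : (Bᶜ \ K).card ≤ 2 * b := by
        have : (Bᶜ \ K).card ≤ Kᶜ.card := Finset.card_le_card fun i hi =>
          Finset.mem_compl.2 (Finset.mem_sdiff.1 hi).2
        rw [Finset.card_compl, hKc, Fintype.card_fin] at this
        omega
      have : ((Bᶜ \ K).card : ℝ) ≤ 2 * b := by exact_mod_cast this
      gcongr
  have hb2 : |∑ i ∈ K \ Bᶜ, (x i - μ)| ≤ b * t₁ := by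
    refine (Finset.abs_sum_le_sum_abs _ _).trans ((Finset.sum_le_card_nsmul _ _ t₁ ?_).trans ?_)
    · intro i hi
      exact hKbound i (Finset.mem_sdiff.1 hi).1
    · rw [nsmul_eq_mul]
      have : (K \ Bᶜ).card ≤ b := by
        refine (Finset.card_le_card fun i hi => ?_).trans hBb
        simpa using (Finset.mem_sdiff.1 hi).2
      have : ((K \ Bᶜ).card : ℝ) ≤ b := by exact_mod_cast this
      gcongr
  rw [hsub, abs_div, abs_of_pos hden]
  have hnum : |∑ i ∈ K, (x i - μ)| ≤ m * (t₂ + 3 * β * t₁) := by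
    rw [hsplit]
    have := abs_add_le (∑ i ∈ Bᶜ, (x i - μ) - ∑ i ∈ Bᶜ \ K, (x i - μ)) (∑ i ∈ K \ Bᶜ, (x i - μ))
    have := abs_sub (∑ i ∈ Bᶜ, (x i - μ)) (∑ i ∈ Bᶜ \ K, (x i - μ))
    have : b * t₁ ≤ β * m * t₁ := by gcongr
    linarith
  rw [div_le_div_iff₀ hden (by linarith)]
  have h3 : (m : ℝ) * (1 - 2 * β) ≤ m - 2 * b := by linarith
  have : 0 ≤ t₂ + 3 * β * t₁ := by positivity
  calc |∑ i ∈ K, (x i - μ)| * (1 - 2 * β) ≤ m * (t₂ + 3 * β * t₁) * (1 - 2 * β) := by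
        gcongr; linarith
    _ = (t₂ + 3 * β * t₁) * (m * (1 - 2 * β)) := by ring
    _ ≤ _ := by gcongr

theorem measurable_trimmedMean {m : ℕ} (β : ℝ) :
    Measurable (trimmedMean β : (Fin m → ℝ) → ℝ) := by
  have hset : ∀ σ : Equiv.Perm (Fin m), MeasurableSet {x : Fin m → ℝ | Tuple.sort x = σ} := by
    intro σ
    have : {x : Fin m → ℝ | Tuple.sort x = σ} = {x | (∀ i j, i ≤ j → x (σ i) ≤ x (σ j)) ∧
        ∀ i j, i < j → x (σ i) = x (σ j) → σ i < σ j} := by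
      ext x
      simp only [Set.mem_ofPred_eq]
      rw [eq_comm, Tuple.eq_sort_iff]
      rfl
    rw [this]
    simp only [Set.ofPred_and, Set.ofPred_forall]
    refine MeasurableSet.inter ?_ ?_
    · refine .iInter fun i => .iInter fun j => .iInter fun _ => ?_
      exact measurableSet_le (measurable_pi_apply _) (measurable_pi_apply _)
    · refine .iInter fun i => .iInter fun j => .iInter fun _ => ?_
      by_cases h : σ i < σ j
      · simp [h]
      · simp only [h, imp_false]
        exact (measurableSet_eq_fun (f := fun x : Fin m → ℝ => x (σ i)) (g := fun x => x (σ j))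
          (measurable_pi_apply _) (measurable_pi_apply _)).compl
  have : (trimmedMean β : (Fin m → ℝ) → ℝ) = fun x => ∑ σ : Equiv.Perm (Fin m),
      {x : Fin m → ℝ | Tuple.sort x = σ}.indicator (fun x =>
        (∑ i : Fin m with ⌊β * m⌋₊ ≤ i.val ∧ i.val + ⌊β * m⌋₊ < m, x (σ i)) /
          ((m : ℝ) - 2 * ⌊β * m⌋₊)) x := by
    ext x
    rw [Finset.sum_eq_single (Tuple.sort x)]
    · simp [trimmedMean]
    · intro σ _ hσ
      exact Set.indicator_of_notMem (s := {x : Fin m → ℝ | Tuple.sort x = σ})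
        (fun h => hσ (Eq.symm h)) _
    · simp
  rw [this]
  refine Finset.measurable_sum _ fun σ _ => Measurable.indicator ?_ (hset σ)
  fun_prop

/-! ### The Euclidean projection -/

section Projection

variable {d : ℕ} {W : Set (Vec d)}

theorem euclProj_spec (hc : IsCompact W) (hne : W.Nonempty) (u : Vec d) :
    euclProj W u ∈ W ∧ ∀ q ∈ W, ‖euclProj W u - u‖ ≤ ‖q - u‖ := by
  obtain ⟨p, hp, hmin⟩ := hc.exists_isMinOn hne
    (f := fun p => ‖p - u‖) (by fun_prop)
  exact Classical.epsilon_spec (p := fun p => p ∈ W ∧ ∀ q ∈ W, ‖p - u‖ ≤ ‖q - u‖)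
    ⟨p, hp, fun q hq => hmin hq⟩

theorem inner_sub_euclProj_nonpos (hW : Convex ℝ W) (hc : IsCompact W) (hne : W.Nonempty)
    (u : Vec d) {q : Vec d} (hq : q ∈ W) :
    inner ℝ (u - euclProj W u) (q - euclProj W u) ≤ 0 := by
  obtain ⟨hp, hmin⟩ := euclProj_spec hc hne u
  refine (norm_eq_iInf_iff_real_inner_le_zero hW hp).1 ?_ q hq
  have : Nonempty W := ⟨⟨_, hp⟩⟩
  refine le_antisymm (le_ciInf fun w => ?_) (ciInf_le ⟨0, ?_⟩ (⟨_, hp⟩ : W))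
  · rw [norm_sub_rev, norm_sub_rev u]
    exact hmin w w.2
  · rintro _ ⟨w, rfl⟩
    exact norm_nonneg _

theorem norm_euclProj_sub_euclProj_le (hW : Convex ℝ W) (hc : IsCompact W) (hne : W.Nonempty)
    (u v : Vec d) : ‖euclProj W u - euclProj W v‖ ≤ ‖u - v‖ := by
  have h1 := inner_sub_euclProj_nonpos hW hc hne u (euclProj_spec hc hne v).1
  have h2 := inner_sub_euclProj_nonpos hW hc hne v (euclProj_spec hc hne u).1
  set p := euclProj W u
  set q := euclProj W v
  have h3 : ‖p - q‖ * ‖p - q‖ ≤ inner ℝ (u - v) (p - q) := by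
    rw [← real_inner_self_eq_norm_mul_norm]
    have e1 : inner ℝ (u - p) (q - p) = - inner ℝ (u - p) (p - q) := by
      rw [← inner_neg_right, neg_sub]
    have e2 : inner ℝ (u - v) (p - q) =
        inner ℝ (u - p) (p - q) + inner ℝ (p - q) (p - q) - inner ℝ (v - q) (p - q) := by
      rw [← inner_add_left, ← inner_sub_left]
      congr 1
      abel
    linarith
  have h4 := h3.trans (real_inner_le_norm _ _)
  rcases (norm_nonneg (p - q)).eq_or_lt with h | h
  · rw [← h]; positivity
  · exact le_of_mul_le_mul_right h4 h

theorem continuous_euclProj (hW : Convex ℝ W) (hc : IsCompact W) (hne : W.Nonempty) :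
    Continuous (euclProj W) :=
  (LipschitzWith.of_dist_le_mul (K := 1) fun u v => by
    simpa [dist_eq_norm] using norm_euclProj_sub_euclProj_le hW hc hne u v).continuous

theorem euclProj_of_mem (hc : IsCompact W) {q : Vec d} (hq : q ∈ W) : euclProj W q = q := by
  have := (euclProj_spec hc ⟨q, hq⟩ q).2 q hq
  rw [sub_self, norm_zero] at this
  exact sub_eq_zero.1 (norm_le_zero_iff.1 this)

end Projection

/-! ### Smooth strongly convex functions -/

section Smooth

variable {d : ℕ} {L : ℝ≥0} {F : Vec d → ℝ}

theorem IsLSmooth.hasFDerivAt (h : IsLSmooth L F) (x : Vec d) :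
    HasFDerivAt F (innerSL ℝ (gradient F x)) x := by
  have := (h.1 x).hasGradientAt.hasFDerivAt
  exact this

theorem IsLSmooth.hasDerivAt_line (h : IsLSmooth L F) (x u : Vec d) (t : ℝ) :
    HasDerivAt (fun t : ℝ => F (x + t • u)) (inner ℝ (gradient F (x + t • u)) u) t := by
  have h1 : HasDerivAt (fun t : ℝ => x + t • u) u t := by
    simpa using ((hasDerivAt_id t).smul_const u).const_add x
  exact (h.hasFDerivAt (x + t • u)).comp_hasDerivAt t h1

theorem IsLSmooth.norm_gradient_sub_le (h : IsLSmooth L F) (x y : Vec d) :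
    ‖gradient F x - gradient F y‖ ≤ L * ‖x - y‖ := by
  simpa [dist_eq_norm] using h.2.dist_le_mul x y

/-- Two-sided descent lemma. -/
theorem IsLSmooth.abs_sub_sub_inner_le (h : IsLSmooth L F) (x u : Vec d) :
    |F (x + u) - F x - inner ℝ (gradient F x) u| ≤ L / 2 * ‖u‖ ^ 2 := by
  have hd : ∀ t : ℝ, HasDerivAt
      (fun t : ℝ => F (x + t • u) - F x - t * inner ℝ (gradient F x) u)
      (inner ℝ (gradient F (x + t • u)) u - inner ℝ (gradient F x) u) t := by
    intro t
    have := ((h.hasDerivAt_line x u t).sub_const (F x)).sub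
      ((hasDerivAt_id t).mul_const (inner ℝ (gradient F x) u))
    rw [one_mul] at this
    exact this
  have hb : ∀ t : ℝ, HasDerivAt (fun t : ℝ => L / 2 * ‖u‖ ^ 2 * t ^ 2) (L * ‖u‖ ^ 2 * t) t := by
    intro t
    have := (hasDerivAt_pow 2 t).const_mul ((L : ℝ) / 2 * ‖u‖ ^ 2)
    convert! this using 1
    push_cast; ring
  have := image_norm_le_of_norm_deriv_right_le_deriv_boundary (a := 0) (b := 1)
    (fun t _ => (hd t).continuousAt.continuousWithinAt) (fun t _ => (hd t).hasDerivWithinAt)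
    (by simp) (fun t => (hb t)) (fun t ht => by
      rw [← inner_sub_left, Real.norm_eq_abs]
      refine (abs_real_inner_le_norm _ _).trans ?_
      have := h.norm_gradient_sub_le (x + t • u) x
      rw [add_sub_cancel_left, norm_smul, Real.norm_eq_abs, abs_of_nonneg ht.1] at this
      calc _ ≤ L * (t * ‖u‖) * ‖u‖ := by gcongr
        _ = _ := by ring) (Set.right_mem_Icc.2 zero_le_one)
  simpa using this

/-- First-order form of strong convexity, from the tangent inequality for the convex function
`F - lam / 2 * ‖·‖ ^ 2` along a line. -/
theorem IsLSmooth.strongConvex_lower (h : IsLSmooth L F) {lam : ℝ}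
    (hs : StrongConvexOn Set.univ lam F) (x u : Vec d) :
    F x + inner ℝ (gradient F x) u + lam / 2 * ‖u‖ ^ 2 ≤ F (x + u) := by
  have hconv := strongConvexOn_iff_convex.1 hs
  have hline : ConvexOn ℝ Set.univ
      (fun t : ℝ => F (x + t • u) - lam / 2 * ‖x + t • u‖ ^ 2) := by
    have := hconv.comp_affineMap (AffineMap.lineMap x (x + u) : ℝ →ᵃ[ℝ] Vec d)
    rw [Set.preimage_univ] at this
    convert! this using 1
    ext t
    simp [AffineMap.lineMap_apply, add_comm]
  have hd : HasDerivAt (fun t : ℝ => F (x + t • u) - lam / 2 * ‖x + t • u‖ ^ 2)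
      (inner ℝ (gradient F x) u - lam * inner ℝ x u) 0 := by
    have h1 := h.hasDerivAt_line x u 0
    have h2 : HasDerivAt (fun t : ℝ => x + t • u) u 0 := by
      simpa using ((hasDerivAt_id (0 : ℝ)).smul_const u).const_add x
    have h3 := (h2.norm_sq).const_mul (lam / 2)
    convert! h1.sub h3 using 1
    simp; ring
  have hsl := hline.le_slope_of_hasDerivAt (Set.mem_univ 0) (Set.mem_univ 1) one_pos hd
  have e : ‖x + u‖ ^ 2 = ‖x‖ ^ 2 + 2 * inner ℝ x u + ‖u‖ ^ 2 := norm_add_sq_real x u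
  simp only [slope_def_field, one_smul, zero_smul, add_zero, sub_zero, div_one, e] at hsl
  linarith

theorem IsLSmooth.le_of_strongConvexOn (h : IsLSmooth L F) {lam : ℝ}
    (hs : StrongConvexOn Set.univ lam F) (hd : 1 ≤ d) : lam ≤ L := by
  have : NeZero d := ⟨by omega⟩
  obtain ⟨u, hu⟩ := exists_ne (0 : Vec d)
  have h1 := h.strongConvex_lower hs 0 u
  have h2 := (abs_le.1 (h.abs_sub_sub_inner_le 0 u)).2
  have h3 : 0 < ‖u‖ ^ 2 := by positivity
  by_contra! hlt
  nlinarith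

/-- Interpolation inequality for `lam`-strongly convex `L`-smooth functions: the co-coercivity of
the gradient of `F - lam / 2 * ‖·‖ ^ 2`, rewritten in terms of `F`. -/
theorem IsLSmooth.interpolation (h : IsLSmooth L F) {lam : ℝ} (hlam : lam ≤ L)
    (hs : StrongConvexOn Set.univ lam F) (x y : Vec d) :
    ‖gradient F x - gradient F y‖ ^ 2 + lam * L * ‖x - y‖ ^ 2 ≤
      (L + lam) * inner ℝ (gradient F x - gradient F y) (x - y) := by
  have upper : ∀ a u : Vec d, F (a + u) ≤ F a + inner ℝ (gradient F a) u + L / 2 * ‖u‖ ^ 2 :=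
    fun a u => by linarith [(abs_le.1 (h.abs_sub_sub_inner_le a u)).2]
  -- One-sided bound: compare the tangent minorant at `a` and the quadratic majorant at `b` of
  -- `F - lam / 2 * ‖·‖ ^ 2` at a gradient step of length `s` from `b`.
  have one : ∀ (a b : Vec d) (s : ℝ),
      F a + inner ℝ (gradient F a) (b - a) + lam / 2 * ‖b - a‖ ^ 2 +
        (s - (L - lam) / 2 * s ^ 2) *
          ‖gradient F b - gradient F a - lam • (b - a)‖ ^ 2 ≤ F b := by
    intro a b s
    set G := gradient F b - gradient F a - lam • (b - a) with hG
    have h1 := h.strongConvex_lower hs a (b - a - s • G)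
    have h2 := upper b (-(s • G))
    have e : a + (b - a - s • G) = b + -(s • G) := by abel
    rw [e] at h1
    have e1 : ‖b - a - s • G‖ ^ 2 =
        ‖b - a‖ ^ 2 - 2 * (s * inner ℝ (b - a) G) + s ^ 2 * ‖G‖ ^ 2 := by
      rw [norm_sub_sq_real, inner_smul_right, norm_smul, mul_pow, Real.norm_eq_abs, sq_abs]
    have e2 : ‖-(s • G)‖ ^ 2 = s ^ 2 * ‖G‖ ^ 2 := by
      rw [norm_neg, norm_smul, mul_pow, Real.norm_eq_abs, sq_abs]
    have e3 : ‖G‖ ^ 2 = inner ℝ (gradient F b) G - inner ℝ (gradient F a) G -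
        lam * inner ℝ (b - a) G := by
      rw [← real_inner_self_eq_norm_sq]
      nth_rw 1 [hG]
      rw [inner_sub_left, inner_sub_left, inner_smul_left]
      rfl
    have e4 : s * _ = s * _ := congrArg (s * ·) e3
    rw [inner_sub_right, inner_smul_right, e1] at h1
    rw [inner_neg_right, inner_smul_right, e2] at h2
    linarith
  set G := gradient F x - gradient F y - lam • (x - y) with hG
  set I := inner ℝ (gradient F x - gradient F y) (x - y) with hI
  have both : ∀ s : ℝ, (2 * s - (L - lam) * s ^ 2) * ‖G‖ ^ 2 ≤ I - lam * ‖x - y‖ ^ 2 := by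
    intro s
    have h1 := one x y s
    have h2 := one y x s
    have e : gradient F y - gradient F x - lam • (y - x) = -G := by
      rw [hG, smul_sub, smul_sub]; abel
    rw [e, norm_neg, norm_sub_rev y x] at h1
    have e' : inner ℝ (gradient F x) (y - x) = - inner ℝ (gradient F x) (x - y) := by
      rw [← inner_neg_right, neg_sub]
    rw [hI, inner_sub_left]
    nlinarith
  have key : ‖G‖ ^ 2 ≤ (L - lam) * (I - lam * ‖x - y‖ ^ 2) := by
    rcases hlam.eq_or_lt with heq | hlt
    · rw [← heq, sub_self, zero_mul]
      by_contra! hpos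
      have := both ((I - lam * ‖x - y‖ ^ 2 + 1) / (2 * ‖G‖ ^ 2))
      rw [← heq, sub_self, zero_mul, sub_zero] at this
      generalize ‖G‖ ^ 2 = c at *
      have e : 2 * ((I - lam * ‖x - y‖ ^ 2 + 1) / (2 * c)) * c = I - lam * ‖x - y‖ ^ 2 + 1 := by
        field_simp
      linarith
    · have hM : 0 < (L : ℝ) - lam := by linarith
      have := both (1 / (L - lam))
      have e : 2 * (1 / ((L : ℝ) - lam)) - (L - lam) * (1 / (L - lam)) ^ 2 = 1 / (L - lam) := by
        field_simp; ring
      rw [e, one_div_mul_eq_div, div_le_iff₀ hM] at this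
      linarith
  have eG : ‖G‖ ^ 2 = ‖gradient F x - gradient F y‖ ^ 2 - 2 * (lam * I) +
      lam ^ 2 * ‖x - y‖ ^ 2 := by
    rw [hG, norm_sub_sq_real, inner_smul_right, norm_smul, mul_pow, Real.norm_eq_abs, sq_abs]
  nlinarith

end Smooth

/-! ### Finite nets -/

/-- Volume bound for the size of a separated subset of a ball. -/
theorem card_le_of_separated_of_subset_ball {d : ℕ} {c : Vec d} {R δ : ℝ} (hδ : 0 < δ) (hR : 0 ≤ R)
    {s : Finset (Vec d)} (hs : ∀ x ∈ s, dist x c ≤ R)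
    (hsep : ∀ x ∈ s, ∀ y ∈ s, x ≠ y → δ ≤ dist x y) :
    (s.card : ℝ) ≤ (1 + 2 * R / δ) ^ d := by
  set μ : Measure (Vec d) := volume
  have hρ : 0 < R + δ / 2 := by positivity
  have hdisj : Set.Pairwise (s : Set (Vec d))
      (Function.onFun Disjoint fun x => Metric.ball x (δ / 2)) := by
    intro x hx y hy hxy
    apply Metric.ball_disjoint_ball
    rw [add_halves]
    exact hsep x hx y hy hxy
  have hsub : (⋃ x ∈ s, Metric.ball x (δ / 2)) ⊆ Metric.ball c (R + δ / 2) :=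
    Set.iUnion₂_subset fun x hx => Metric.ball_subset_ball' (by linarith [hs x hx])
  have hvol : (s.card : ENNReal) * ENNReal.ofReal ((δ / 2) ^ d) * μ (Metric.ball 0 1) ≤
      ENNReal.ofReal ((R + δ / 2) ^ d) * μ (Metric.ball 0 1) := by
    have h1 := measure_mono (μ := μ) hsub
    rw [measure_biUnion_finset hdisj fun x _ => Metric.isOpen_ball.measurableSet] at h1
    simp only [μ.addHaar_ball_of_pos _ hρ, μ.addHaar_ball_of_pos _ (half_pos hδ),
      Finset.sum_const, nsmul_eq_mul, finrank_euclideanSpace, Fintype.card_fin] at h1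
    rwa [mul_assoc]
  have hcard := (ENNReal.mul_le_mul_iff_left
    (Metric.measure_ball_pos μ _ zero_lt_one).ne' measure_ball_lt_top.ne).1 hvol
  have h2 := ENNReal.toReal_le_of_le_ofReal (by positivity) hcard
  rw [ENNReal.toReal_mul, ENNReal.toReal_natCast, ENNReal.toReal_ofReal (by positivity)] at h2
  have e : 1 + 2 * R / δ = (R + δ / 2) / (δ / 2) := by field_simp; ring
  rw [e, div_pow, le_div_iff₀ (by positivity)]
  exact h2

/-- A subset of a ball of radius `R` has an internal `δ`-net of size at most `(1 + 2 R / δ) ^ d`: a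
`δ`-separated subset of maximal size. -/
theorem exists_net {d : ℕ} {A : Set (Vec d)} {c : Vec d} {R δ : ℝ} (hδ : 0 < δ) (hR : 0 ≤ R)
    (hA : ∀ x ∈ A, dist x c ≤ R) :
    ∃ s : Finset (Vec d), (∀ x ∈ s, x ∈ A) ∧ (s.card : ℝ) ≤ (1 + 2 * R / δ) ^ d ∧
      ∀ x ∈ A, ∃ y ∈ s, dist x y ≤ δ := by
  classical
  let Q : ℕ → Prop := fun N => ∃ s : Finset (Vec d), (∀ x ∈ s, x ∈ A) ∧
    (∀ x ∈ s, ∀ y ∈ s, x ≠ y → δ ≤ dist x y) ∧ s.card = N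
  obtain ⟨M, hM⟩ := exists_nat_ge ((1 + 2 * R / δ) ^ d)
  have hQ0 : Q 0 := ⟨∅, by simp, by simp, rfl⟩
  obtain ⟨s, hsA, hsep, hscard⟩ := Nat.findGreatest_spec (Nat.zero_le M) hQ0
  refine ⟨s, hsA, card_le_of_separated_of_subset_ball hδ hR (fun x hx => hA x (hsA x hx)) hsep, ?_⟩
  intro x hx
  by_contra! hcon
  have hxs : x ∉ s := fun h => by simpa using (hcon x h).trans' hδ
  have hsep' : ∀ y ∈ insert x s, ∀ z ∈ insert x s, y ≠ z → δ ≤ dist y z := by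
    intro y hy z hz hyz
    rcases Finset.mem_insert.1 hy with rfl | hy' <;> rcases Finset.mem_insert.1 hz with rfl | hz'
    · exact absurd rfl hyz
    · exact (hcon z hz').le
    · rw [dist_comm]; exact (hcon y hy').le
    · exact hsep y hy' z hz' hyz
  have hA' : ∀ y ∈ insert x s, y ∈ A := fun y hy =>
    (Finset.mem_insert.1 hy).elim (fun h => h ▸ hx) (hsA y)
  have hle : s.card + 1 ≤ M := by
    have := (card_le_of_separated_of_subset_ball hδ hR (fun y hy => hA y (hA' y hy)) hsep').trans hM
    rw [Finset.card_insert_of_notMem hxs] at this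
    exact_mod_cast this
  have := Nat.le_findGreatest (P := Q) hle
    ⟨insert x s, hA', hsep', Finset.card_insert_of_notMem hxs⟩
  omega

/-! ### Concentration of sums of sub-exponential variables -/

section Concentration

variable {Ω Γ ι : Type*} [MeasurableSpace Ω] [MeasurableSpace Γ] {P : Measure Ω}
  [IsProbabilityMeasure P] {𝔻 : Measure Γ} {X : ι → Ω → Γ} {v : ℝ} {Y : Γ → ℝ}

theorem IsSubExponential.neg (h : IsSubExponential v Y 𝔻) :
    IsSubExponential v (fun γ => -Y γ) 𝔻 := by
  refine ⟨h.1.neg, fun s hs => ?_⟩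
  have := h.2 (-s) (by rwa [abs_neg])
  simp only [integral_neg, neg_sq] at this ⊢
  have e : ∀ γ, s * (-Y γ - -∫ γ', Y γ' ∂𝔻) = -s * (Y γ - ∫ γ', Y γ' ∂𝔻) := fun γ => by ring
  simp only [e]
  exact this

/-- Version of `iIndepFun.integrable_exp_mul_sum` for almost everywhere measurable variables. -/
theorem integrable_exp_mul_sum {Z : ι → Ω → ℝ} (hZ : iIndepFun Z P)
    (hZm : ∀ i, AEMeasurable (Z i) P) {S : Finset ι} {t : ℝ}
    (hint : ∀ i ∈ S, Integrable (fun ω => Real.exp (t * Z i ω)) P) :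
    Integrable (fun ω => Real.exp (t * (∑ i ∈ S, Z i) ω)) P := by
  have hind : iIndepFun (fun i => (hZm i).mk (Z i)) P := hZ.congr fun i => (hZm i).ae_eq_mk
  have h := hind.integrable_exp_mul_sum (fun i => (hZm i).measurable_mk) (s := S) (t := t)
    fun i hi => (hint i hi).congr <| by
      filter_upwards [(hZm i).ae_eq_mk] with ω hω
      rw [hω]
  refine h.congr ?_
  have hall : ∀ᵐ ω ∂P, ∀ i ∈ S, Z i ω = (hZm i).mk (Z i) ω :=
    (ae_ball_iff S.countable_toSet).2 fun i _ => (hZm i).ae_eq_mk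
  filter_upwards [hall] with ω hω
  simp only [Finset.sum_apply]
  rw [Finset.sum_congr rfl fun i hi => (hω i hi).symm]

/-- Chernoff bound for the upper tail of a sum of at most `N` independent `v`-sub-exponential
variables. The two terms of the threshold correspond to the Gaussian and to the exponential
regime. -/
theorem measureReal_sum_ge_le (hv : 0 < v) (hY : IsSubExponential v Y 𝔻)
    (hXm : ∀ i, Measurable (X i)) (hX : iIndepFun X P) (hlaw : ∀ i, P.map (X i) = 𝔻)
    (S : Finset ι) {N A : ℝ} (hN : 0 < N) (hS : (S.card : ℝ) ≤ N) (hA : 0 ≤ A) :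
    P.real {ω | v * √(2 * N * A) + 4 * v * A ≤ ∑ i ∈ S, (Y (X i ω) - ∫ γ, Y γ ∂𝔻)} ≤
      Real.exp (-A) := by
  set u := v * √(2 * N * A) + 4 * v * A with hu
  set Z : ι → Ω → ℝ := fun i ω => Y (X i ω) - ∫ γ, Y γ ∂𝔻 with hZ
  have hYm : AEMeasurable (fun γ => Y γ - ∫ γ', Y γ' ∂𝔻) 𝔻 := hY.1.aemeasurable.sub_const _
  have hZm : ∀ i, AEMeasurable (Z i) P := fun i =>
    AEMeasurable.comp_measurable (g := fun γ => Y γ - ∫ γ', Y γ' ∂𝔻) (f := X i)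
      (by rw [hlaw i]; exact hYm) (hXm i)
  have hZind : iIndepFun Z P := by
    refine iIndepFun.comp₀ hX (fun _ γ => Y γ - ∫ γ', Y γ' ∂𝔻) (fun i => (hXm i).aemeasurable) ?_
    intro i
    rw [hlaw i]
    exact hYm
  -- Any `s` in the range of the sub-exponential bound yields a tail bound.
  have chernoff : ∀ s : ℝ, 0 ≤ s → s < 1 / v →
      P.real {ω | u ≤ ∑ i ∈ S, Z i ω} ≤ Real.exp (-s * u + N * (v ^ 2 * s ^ 2 / 2)) := by
    intro s hs0 hs
    have hsub := hY.2 s (by rwa [abs_of_nonneg hs0])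
    have hint : ∀ i, Integrable (fun ω => Real.exp (s * Z i ω)) P := by
      intro i
      have h : Integrable (fun γ => Real.exp (s * (Y γ - ∫ γ', Y γ' ∂𝔻))) (P.map (X i)) := by
        rw [hlaw i]
        exact hsub.1
      exact (integrable_map_measure h.aestronglyMeasurable (hXm i).aemeasurable).1 h
    have hmgf : ∀ i, mgf (Z i) P s ≤ Real.exp (v ^ 2 * s ^ 2 / 2) := by
      intro i
      have h1 := hsub.1.aestronglyMeasurable
      have h2 := hsub.2
      rw [← hlaw i] at h1 h2
      rw [integral_map (hXm i).aemeasurable h1, hlaw i] at h2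
      exact h2
    have h1 := measure_ge_le_exp_mul_mgf (μ := P) (X := ∑ i ∈ S, Z i) u hs0
      (integrable_exp_mul_sum hZind hZm fun i _ => hint i)
    have e : (fun ω => ∑ i ∈ S, Z i ω) = ∑ i ∈ S, Z i := by ext; simp
    have e' : {ω | u ≤ ∑ i ∈ S, Z i ω} = {ω | u ≤ (∑ i ∈ S, Z i) ω} := by simp
    rw [e']
    refine h1.trans ?_
    rw [hZind.mgf_sum₀ hZm, Real.exp_add]
    gcongr
    calc ∏ i ∈ S, mgf (Z i) P s ≤ ∏ i ∈ S, Real.exp (v ^ 2 * s ^ 2 / 2) :=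
          Finset.prod_le_prod (fun i _ => mgf_nonneg) fun i _ => hmgf i
      _ = Real.exp (S.card * (v ^ 2 * s ^ 2 / 2)) := by
          rw [Finset.prod_const, ← Real.exp_nat_mul]
      _ ≤ _ := by gcongr
  by_cases hreg : 2 * A < N
  · -- Gaussian regime: `s` is optimal for the leading part of the threshold
    have hr : √(2 * A / N) < 1 := by
      rw [Real.sqrt_lt' one_pos, one_pow, div_lt_one hN]
      exact hreg
    refine (chernoff (√(2 * A / N) / v) (by positivity)
      (by gcongr)).trans (Real.exp_le_exp.2 ?_)
    have e1 : √(2 * A / N) * √(2 * N * A) = 2 * A := by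
      rw [← Real.sqrt_mul (by positivity)]
      have : 2 * A / N * (2 * N * A) = (2 * A) ^ 2 := by field_simp
      rw [this, Real.sqrt_sq (by positivity)]
    have e2 : v ^ 2 * (√(2 * A / N) / v) ^ 2 = 2 * A / N := by
      rw [div_pow, Real.sq_sqrt (by positivity)]
      field_simp
    have e3 : √(2 * A / N) / v * (v * √(2 * N * A)) = 2 * A := by
      rw [div_mul_eq_mul_div, mul_left_comm, e1, mul_div_cancel_left₀ _ hv.ne']
    have e4 : 0 ≤ √(2 * A / N) / v * (4 * v * A) := by positivity
    rw [e2, hu]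
    have e5 : N * (2 * A / N / 2) = A := by field_simp
    rw [e5]
    linarith
  · -- exponential regime: that `s` is out of range, and `s = 1 / (2 v)` suffices
    refine (chernoff (1 / (2 * v)) (by positivity) (by gcongr; linarith)).trans
      (Real.exp_le_exp.2 ?_)
    have e2 : v ^ 2 * (1 / (2 * v)) ^ 2 = 1 / 4 := by field_simp; norm_num
    have e3 : 1 / (2 * v) * (4 * v * A) = 2 * A := by field_simp; norm_num
    have e4 : 0 ≤ 1 / (2 * v) * (v * √(2 * N * A)) := by positivity
    rw [e2, hu]
    linarith

theorem measureReal_abs_sum_ge_le (hv : 0 < v) (hY : IsSubExponential v Y 𝔻)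
    (hXm : ∀ i, Measurable (X i)) (hX : iIndepFun X P) (hlaw : ∀ i, P.map (X i) = 𝔻)
    (S : Finset ι) {N A : ℝ} (hN : 0 < N) (hS : (S.card : ℝ) ≤ N) (hA : 0 ≤ A) :
    P.real {ω | v * √(2 * N * A) + 4 * v * A ≤ |∑ i ∈ S, (Y (X i ω) - ∫ γ, Y γ ∂𝔻)|} ≤
      2 * Real.exp (-A) := by
  have h1 := measureReal_sum_ge_le hv hY hXm hX hlaw S hN hS hA
  have h2 := measureReal_sum_ge_le hv hY.neg hXm hX hlaw S hN hS hA
  have hsub : {ω | v * √(2 * N * A) + 4 * v * A ≤ |∑ i ∈ S, (Y (X i ω) - ∫ γ, Y γ ∂𝔻)|} ⊆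
      {ω | v * √(2 * N * A) + 4 * v * A ≤ ∑ i ∈ S, (Y (X i ω) - ∫ γ, Y γ ∂𝔻)} ∪
      {ω | v * √(2 * N * A) + 4 * v * A ≤ ∑ i ∈ S, (-Y (X i ω) - ∫ γ, -Y γ ∂𝔻)} := by
    intro ω hω
    have e : ∑ i ∈ S, (-Y (X i ω) - ∫ γ, -Y γ ∂𝔻) = -∑ i ∈ S, (Y (X i ω) - ∫ γ, Y γ ∂𝔻) := by
      rw [← Finset.sum_neg_distrib]
      refine Finset.sum_congr rfl fun i _ => ?_
      rw [integral_neg]; ring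
    simp only [Set.mem_union, Set.mem_ofPred_eq, e] at hω ⊢
    exact le_abs.1 hω
  calc _ ≤ _ := measureReal_mono hsub
    _ ≤ _ := measureReal_union_le _ _
    _ ≤ _ := by linarith

end Concentration

/-! ### Second moments of the uniform distribution on the sphere -/

section Sphere

variable {d : ℕ}

/-- The action of a linear isometry on the unit sphere. -/
noncomputable def sphereMap (f : Vec d ≃ₗᵢ[ℝ] Vec d) (z : UnitSphere d) : UnitSphere d :=
  ⟨f z, by simp⟩

theorem continuous_sphereMap (f : Vec d ≃ₗᵢ[ℝ] Vec d) : Continuous (sphereMap f) :=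
  (f.continuous.comp continuous_subtype_val).subtype_mk _

open scoped Pointwise in
theorem measurePreserving_sphereMap (f : Vec d ≃ₗᵢ[ℝ] Vec d) :
    MeasurePreserving (sphereMap f) (uniformSphere d) (uniformSphere d) := by
  have hm : Measurable (sphereMap f) := (continuous_sphereMap f).measurable
  have key : MeasurePreserving (sphereMap f) (volume : Measure (Vec d)).toSphere
      (volume : Measure (Vec d)).toSphere := by
    refine ⟨hm, ?_⟩
    ext s hs
    rw [Measure.map_apply hm hs, Measure.toSphere_apply' _ (hm hs), Measure.toSphere_apply' _ hs]
    congr 1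
    rw [← f.measurePreserving.measure_preimage_emb f.toHomeomorph.measurableEmbedding
      (Set.Ioo (0 : ℝ) 1 • (Subtype.val '' s))]
    congr 1
    ext x
    simp only [Set.mem_smul, Set.mem_image, Set.mem_preimage]
    constructor
    · rintro ⟨c, hc, _, ⟨z, hz, rfl⟩, rfl⟩
      exact ⟨c, hc, f z, ⟨sphereMap f z, hz, rfl⟩, (map_smul f c (z : Vec d)).symm⟩
    · rintro ⟨c, hc, _, ⟨z, hz, rfl⟩, h⟩
      refine ⟨c, hc, f.symm z, ⟨sphereMap f.symm z, ?_, rfl⟩, ?_⟩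
      · have : sphereMap f (sphereMap f.symm z) = z := Subtype.ext (by simp [sphereMap])
        rwa [this]
      · apply f.injective
        rw [map_smul, f.apply_symm_apply]
        exact h
  exact ⟨hm, by rw [uniformSphere, Measure.map_smul, key.map_eq]⟩

theorem integrable_of_continuous_compactSpace {X E : Type*} [TopologicalSpace X] [CompactSpace X]
    [MeasurableSpace X] [OpensMeasurableSpace X] [NormedAddCommGroup E] [SecondCountableTopology E]
    {μ : Measure X} [IsFiniteMeasure μ] {φ : X → E} (hφ : Continuous φ) : Integrable φ μ :=
  hφ.integrable_of_hasCompactSupport (HasCompactSupport.of_compactSpace φ)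

/-- The uniform distribution on the sphere has covariance `1 / d` times the identity. -/
theorem integral_inner_mul_inner (hd : 1 ≤ d) (a b : Vec d) :
    ∫ z : UnitSphere d, inner ℝ a (z : Vec d) * inner ℝ b (z : Vec d) ∂(uniformSphere d) =
      inner ℝ a b / d := by
  have := isProbabilityMeasure_uniformSphere hd
  have hd0 : (d : ℝ) ≠ 0 := by positivity
  set q : Vec d → ℝ := fun a => ∫ z : UnitSphere d, inner ℝ a (z : Vec d) ^ 2 ∂(uniformSphere d)
    with hq
  have hint : ∀ a b : Vec d, Integrable
      (fun z : UnitSphere d => inner ℝ a (z : Vec d) * inner ℝ b (z : Vec d))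
      (uniformSphere d) := fun a b =>
    integrable_of_continuous_compactSpace (by fun_prop)
  -- A reflection exchanges two given vectors of equal norm, so `q` depends on the norm only.
  have hq_norm : ∀ a b : Vec d, ‖a‖ = ‖b‖ → q a = q b := by
    intro a b hab
    set f := (ℝ ∙ (a - b))ᗮ.reflection with hf
    have hfa : f a = b := Submodule.reflection_sub hab
    have hpres := measurePreserving_sphereMap f
    have hcont : Continuous fun z : UnitSphere d => inner ℝ b (z : Vec d) ^ 2 := by fun_prop
    simp only [hq]
    rw [← hpres.map_eq, integral_map hpres.measurable.aemeasurable hcont.aestronglyMeasurable,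
      hpres.map_eq]
    refine integral_congr_ae (.of_forall fun z => ?_)
    simp only [sphereMap]
    rw [← hfa, f.inner_map_map]
  have hq_smul : ∀ (c : ℝ) (a : Vec d), q (c • a) = c ^ 2 * q a := by
    intro c a
    simp only [hq, inner_smul_left, mul_pow]
    rw [integral_const_mul]
    rfl
  have hbasis : ∀ i : Fin d, q (EuclideanSpace.single i 1) = 1 / d := by
    have hsum : ∑ i : Fin d, q (EuclideanSpace.single i 1) = 1 := by
      simp only [hq]
      rw [← integral_finsetSum]
      · have : ∀ z : UnitSphere d,
            ∑ i : Fin d, inner ℝ (EuclideanSpace.single i (1 : ℝ)) (z : Vec d) ^ 2 = 1 := by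
          intro z
          have hz : ‖(z : Vec d)‖ = 1 := by simp
          rw [EuclideanSpace.norm_eq, Real.sqrt_eq_one] at hz
          simpa [EuclideanSpace.inner_single_left] using hz
        simp [this]
      · intro i _
        simpa only [sq] using hint _ _
    intro i
    have : ∀ j, q (EuclideanSpace.single j 1) = q (EuclideanSpace.single i 1) := fun j =>
      hq_norm _ _ (by simp)
    rw [Finset.sum_congr rfl fun j _ => this j] at hsum
    simp only [Finset.sum_const, Finset.card_univ, Fintype.card_fin, nsmul_eq_mul] at hsum
    field_simp
    linarith
  have hq_eq : ∀ a : Vec d, q a = ‖a‖ ^ 2 / d := by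
    intro a
    have : q a = q (‖a‖ • EuclideanSpace.single ⟨0, hd⟩ 1) := hq_norm _ _ (by simp [norm_smul])
    rw [this, hq_smul, hbasis]
    ring
  -- polarization
  have hpol : ∀ z : UnitSphere d, inner ℝ a (z : Vec d) * inner ℝ b (z : Vec d) =
      (inner ℝ (a + b) (z : Vec d) ^ 2 - inner ℝ (a - b) (z : Vec d) ^ 2) / 4 := by
    intro z
    rw [inner_add_left, inner_sub_left]
    ring
  simp only [hpol]
  rw [integral_div, integral_sub (by simpa only [sq] using hint _ _)
    (by simpa only [sq] using hint _ _)]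
  change (q (a + b) - q (a - b)) / 4 = _
  rw [hq_eq, hq_eq, norm_add_sq_real, norm_sub_sq_real]
  ring

variable {k : ℕ}

/-- The exact zero-order estimate with `k` random directions of a gradient `g`. -/
noncomputable def batchEstimate (g : Vec d) (z : Fin k → UnitSphere d) : Vec d :=
  (1 / (k : ℝ)) • ∑ r, (d * inner ℝ g (z r : Vec d)) • (z r : Vec d)

theorem continuous_batchEstimate (g : Vec d) :
    Continuous (batchEstimate g : (Fin k → UnitSphere d) → Vec d) := by
  unfold batchEstimate
  fun_prop

/-- The law of one batch of directions. -/
noncomputable abbrev batchLaw (d k : ℕ) : Measure (Fin k → UnitSphere d) :=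
  Measure.pi fun _ => uniformSphere d

theorem integral_batchLaw_eval (hd : 1 ≤ d) (r : Fin k) {φ : UnitSphere d → ℝ}
    (hφ : Continuous φ) : ∫ z, φ (z r) ∂(batchLaw d k) = ∫ z, φ z ∂(uniformSphere d) := by
  have := isProbabilityMeasure_uniformSphere hd
  have h := measurePreserving_eval (fun _ : Fin k => uniformSphere d) r
  rw [← h.map_eq, integral_map h.measurable.aemeasurable hφ.aestronglyMeasurable]

theorem integral_inner_batchEstimate (hd : 1 ≤ d) (hk : 1 ≤ k) (g u : Vec d) :
    ∫ z, inner ℝ u (batchEstimate g z) ∂(batchLaw d k) = inner ℝ g u := by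
  have := isProbabilityMeasure_uniformSphere hd
  have e : ∀ z : Fin k → UnitSphere d, inner ℝ u (batchEstimate g z) =
      (d / k : ℝ) * ∑ r, inner ℝ g (z r : Vec d) * inner ℝ u (z r : Vec d) := by
    intro z
    simp only [batchEstimate, inner_smul_right, inner_sum, mul_assoc, ← Finset.mul_sum]
    ring
  simp only [e]
  rw [integral_const_mul, integral_finsetSum]
  · have : ∀ r : Fin k, ∫ z, inner ℝ g (z r : Vec d) * inner ℝ u (z r : Vec d) ∂(batchLaw d k) =
        inner ℝ g u / d := fun r => by
      rw [← integral_inner_mul_inner hd]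
      exact integral_batchLaw_eval hd r
        (φ := fun z => inner ℝ g (z : Vec d) * inner ℝ u (z : Vec d)) (by fun_prop)
    simp only [this, Finset.sum_const, Finset.card_univ, Fintype.card_fin, nsmul_eq_mul]
    field_simp
  · intro r _
    exact integrable_of_continuous_compactSpace (by fun_prop)

/-- Second moment of the estimate: of the `k ^ 2` pairs of directions, the `k` diagonal ones
contribute `d ‖g‖ ^ 2` each, the others, being independent, `‖g‖ ^ 2`. -/
theorem integral_norm_sq_batchEstimate (hd : 1 ≤ d) (hk : 1 ≤ k) (g : Vec d) :
    ∫ z, ‖batchEstimate g z‖ ^ 2 ∂(batchLaw d k) = ((d : ℝ) + k - 1) / k * ‖g‖ ^ 2 := by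
  have := isProbabilityMeasure_uniformSphere hd
  have e : ∀ z : Fin k → UnitSphere d, ‖batchEstimate g z‖ ^ 2 = (d / k : ℝ) ^ 2 * ∑ r, ∑ s,
      inner ℝ g (z r : Vec d) * inner ℝ g (z s : Vec d) * inner ℝ (z r : Vec d) (z s : Vec d) := by
    intro z
    rw [← real_inner_self_eq_norm_sq]
    simp only [batchEstimate, inner_smul_right, inner_smul_left, inner_sum, sum_inner,
      Finset.mul_sum]
    refine Finset.sum_congr rfl fun r _ => Finset.sum_congr rfl fun s _ => ?_
    simp only [conj_trivial]
    rw [real_inner_comm (z r : Vec d) (z s : Vec d)]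
    ring
  have hterm : ∀ r s : Fin k, ∫ z, inner ℝ g (z r : Vec d) * inner ℝ g (z s : Vec d) *
      inner ℝ (z r : Vec d) (z s : Vec d) ∂(batchLaw d k) =
      if r = s then ‖g‖ ^ 2 / d else ‖g‖ ^ 2 / d ^ 2 := by
    intro r s
    split_ifs with hrs
    · subst hrs
      have h1 : ∀ z : Fin k → UnitSphere d, inner ℝ (z r : Vec d) (z r : Vec d) = 1 := fun z => by
        rw [real_inner_self_eq_norm_sq]; simp
      simp only [h1, mul_one]
      rw [integral_batchLaw_eval hd r
        (φ := fun z => inner ℝ g (z : Vec d) * inner ℝ g (z : Vec d)) (by fun_prop),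
        integral_inner_mul_inner hd, real_inner_self_eq_norm_sq]
    · have hind : IndepFun (fun z : Fin k → UnitSphere d => z r) (fun z => z s) (batchLaw d k) :=
        (iIndepFun_pi (μ := fun _ : Fin k => uniformSphere d) (X := fun _ z => z)
          fun _ => aemeasurable_id).indepFun hrs
      have h1 : ∀ z : Fin k → UnitSphere d, inner ℝ g (z r : Vec d) * inner ℝ g (z s : Vec d) *
          inner ℝ (z r : Vec d) (z s : Vec d) = ∑ i : Fin d,
          (inner ℝ g (z r : Vec d) * (z r : Vec d) i) *
            (inner ℝ g (z s : Vec d) * (z s : Vec d) i) := by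
        intro z
        rw [PiLp.inner_apply (z r : Vec d), Finset.mul_sum]
        refine Finset.sum_congr rfl fun i _ => ?_
        simp only [RCLike.inner_apply, conj_trivial]
        ring
      simp only [h1]
      rw [integral_finsetSum _ fun i _ => integrable_of_continuous_compactSpace (by fun_prop)]
      have h2 : ∀ i : Fin d, ∫ z : Fin k → UnitSphere d,
          (inner ℝ g (z r : Vec d) * (z r : Vec d) i) *
            (inner ℝ g (z s : Vec d) * (z s : Vec d) i) ∂(batchLaw d k) = (g i / d) ^ 2 := by
        intro i
        set ψ : UnitSphere d → ℝ := fun z => inner ℝ g (z : Vec d) * (z : Vec d) i with hψ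
        have hψc : Continuous ψ := by fun_prop
        have h3 : ∫ z, ψ z ∂(uniformSphere d) = g i / d := by
          have := integral_inner_mul_inner hd g (EuclideanSpace.single i 1)
          simpa [EuclideanSpace.inner_single_left, EuclideanSpace.inner_single_right] using this
        have h4 := (hind.comp hψc.measurable hψc.measurable).integral_fun_mul_eq_mul_integral
          (hψc.comp (continuous_apply r)).aestronglyMeasurable
          (hψc.comp (continuous_apply s)).aestronglyMeasurable
        refine h4.trans ?_
        have h5 : ∀ r : Fin k, ∫ z, (ψ ∘ fun z : Fin k → UnitSphere d => z r) z ∂(batchLaw d k) =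
          g i / d := fun r => (integral_batchLaw_eval hd r hψc).trans h3
        rw [h5, h5, sq]
      simp only [h2, div_pow]
      rw [← Finset.sum_div, EuclideanSpace.norm_sq_eq]
      simp
  simp only [e]
  rw [integral_const_mul, integral_finsetSum _ fun i _ =>
    integrable_of_continuous_compactSpace (by fun_prop)]
  have hrow : ∀ r : Fin k, ∫ z, ∑ s, inner ℝ g (z r : Vec d) * inner ℝ g (z s : Vec d) *
      inner ℝ (z r : Vec d) (z s : Vec d) ∂(batchLaw d k) =
      ‖g‖ ^ 2 / d + (k - 1) * (‖g‖ ^ 2 / d ^ 2) := by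
    intro r
    rw [integral_finsetSum _ fun i _ => integrable_of_continuous_compactSpace (by fun_prop)]
    simp only [hterm]
    rw [← Finset.add_sum_erase _ _ (Finset.mem_univ r), if_pos rfl,
      Finset.sum_congr rfl fun s hs => if_neg (Finset.ne_of_mem_erase hs).symm, Finset.sum_const,
      Finset.card_erase_of_mem (Finset.mem_univ r), Finset.card_univ, Fintype.card_fin,
      nsmul_eq_mul, Nat.cast_sub hk, Nat.cast_one]
  simp only [hrow, Finset.sum_const, Finset.card_univ, Fintype.card_fin, nsmul_eq_mul]
  have : (d : ℝ) ≠ 0 := by positivity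
  have : (k : ℝ) ≠ 0 := by positivity
  field_simp
  ring

theorem integral_le_of_integral_sq_le {Ω : Type*} [MeasurableSpace Ω] {P : Measure Ω}
    [IsProbabilityMeasure P] {φ : Ω → ℝ} (hφ : MemLp φ 2 P) {R : ℝ} (hR : 0 ≤ R)
    (h : ∫ ω, φ ω ^ 2 ∂P ≤ R ^ 2) : ∫ ω, φ ω ∂P ≤ R := by
  have h1 := variance_nonneg φ P
  rw [variance_eq_sub hφ] at h1
  refine abs_le_of_sq_le_sq' ?_ hR |>.2
  have : ∫ ω, (φ ^ 2) ω ∂P = ∫ ω, φ ω ^ 2 ∂P := rfl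
  linarith

/-- One exact step contracts the distance to the optimum in expectation. Here `u` is the error
vector and `g` the gradient; the step size balances the second moment `τ ‖g‖ ^ 2` of the
estimate against the gradient term of the interpolation inequality. -/
theorem integral_norm_sub_batchEstimate_le (hd : 1 ≤ d) (hk : 1 ≤ k) {L lam τ η : ℝ}
    (hlam : 0 < lam) (hL : lam ≤ L) (hτ : τ = ((d : ℝ) + k - 1) / k) (hη : η = 1 / (τ * L))
    {g u : Vec d} (h : ‖g‖ ^ 2 + lam * L * ‖u‖ ^ 2 ≤ (L + lam) * inner ℝ g u) :
    ∫ z, ‖u - η • batchEstimate g z‖ ∂(batchLaw d k) ≤ (1 - lam / (τ * (L + lam))) * ‖u‖ := by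
  have := isProbabilityMeasure_uniformSphere hd
  have hL0 : 0 < L := hlam.trans_le hL
  have hd1 : (1 : ℝ) ≤ d := by exact_mod_cast hd
  have hk1 : (1 : ℝ) ≤ k := by exact_mod_cast hk
  have hτ1 : 1 ≤ τ := by rw [hτ, le_div_iff₀ (by positivity)]; linarith
  have hτ0 : 0 < τ := one_pos.trans_le hτ1
  have hη0 : 0 < η := by rw [hη]; positivity
  have hc := continuous_batchEstimate (k := k) g
  set p := lam / (τ * (L + lam)) with hp
  have hp1 : p ≤ 1 := by
    rw [hp, div_le_one (by positivity)]
    nlinarith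
  have hcont : Continuous fun z : Fin k → UnitSphere d => ‖u - η • batchEstimate g z‖ := by
    fun_prop
  refine integral_le_of_integral_sq_le ?_ (mul_nonneg (by linarith) (norm_nonneg _)) ?_
  · rw [memLp_two_iff_integrable_sq hcont.aestronglyMeasurable]
    exact integrable_of_continuous_compactSpace (by fun_prop)
  have e : ∀ z : Fin k → UnitSphere d, ‖u - η • batchEstimate g z‖ ^ 2 =
      ‖u‖ ^ 2 - 2 * η * inner ℝ u (batchEstimate g z) + η ^ 2 * ‖batchEstimate g z‖ ^ 2 := by
    intro z
    rw [norm_sub_sq_real, inner_smul_right, norm_smul, mul_pow, Real.norm_eq_abs, sq_abs]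
    ring
  simp only [e]
  rw [integral_add (integrable_of_continuous_compactSpace (by fun_prop))
    (integrable_of_continuous_compactSpace (by fun_prop)),
    integral_sub (integrable_const _) (integrable_of_continuous_compactSpace (by fun_prop)),
    integral_const_mul, integral_const_mul, integral_inner_batchEstimate hd hk,
    integral_norm_sq_batchEstimate hd hk, ← hτ, integral_const, probReal_univ, one_smul]
  have hητ : η * τ * L = 1 := by rw [hη]; field_simp
  have hpη : p * (L + lam) = lam * L * η := by rw [hp, hη]; field_simp
  -- `η ^ 2 τ = η / L ≤ 2 η / (L + lam)`, so the interpolation inequality absorbs the second moment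
  have h1 : η ^ 2 * τ * (L + lam) ≤ 2 * η := by
    have : η ^ 2 * τ * (L + lam) = η * (η * τ * L) + η * (η * τ * L) * (lam / L) := by
      field_simp
    rw [this, hητ]
    have : lam / L ≤ 1 := (div_le_one hL0).2 hL
    nlinarith
  have h2 : (L + lam) * (‖u‖ ^ 2 - 2 * η * inner ℝ g u + η ^ 2 * (τ * ‖g‖ ^ 2)) ≤
      (L + lam) * ((1 - 2 * p) * ‖u‖ ^ 2) := by
    have h3 : 2 * η * (‖g‖ ^ 2 + lam * L * ‖u‖ ^ 2) ≤ 2 * η * ((L + lam) * inner ℝ g u) := by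
      gcongr
    have h4 : η ^ 2 * τ * (L + lam) * ‖g‖ ^ 2 ≤ 2 * η * ‖g‖ ^ 2 := by gcongr
    have h5 : p * (L + lam) * ‖u‖ ^ 2 = lam * L * η * ‖u‖ ^ 2 := by rw [hpη]
    linarith
  have h6 := le_of_mul_le_mul_left h2 (by positivity)
  have h7 : 0 ≤ p ^ 2 * ‖u‖ ^ 2 := by positivity
  nlinarith

end Sphere

/-! ### The population estimate -/

section Population

variable {d : ℕ} {Γ : Type*} [MeasurableSpace Γ] {𝔻 : Measure Γ} {f : Vec d → Γ → ℝ}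

theorem zoCoeff_zero (h : Vec d → ℝ) (w z : Vec d) :
    zoCoeff h 0 w z = d * inner ℝ (gradient h w) z := by
  simp [zoCoeff]

/-- Differentiation under the integral sign, in the direction `z`. By smoothness both sides are
(up to the factor `d`) derivatives at `0` of `t ↦ F (w + t z)`. -/
theorem integral_zoCoeff [IsProbabilityMeasure 𝔻] (hf : ∀ w, Integrable (f w) 𝔻) {L LF : ℝ≥0}
    (hs : ∀ γ, IsLSmooth L fun w => f w γ) (hF : IsLSmooth LF (populationLoss f 𝔻))
    (hd : 1 ≤ d) {w z : Vec d} (hint : Integrable (fun γ => zoCoeff (fun u => f u γ) 0 w z) 𝔻) :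
    ∫ γ, zoCoeff (fun u => f u γ) 0 w z ∂𝔻 = d * inner ℝ (gradient (populationLoss f 𝔻) w) z := by
  have hd0 : (d : ℝ) ≠ 0 := by positivity
  simp only [zoCoeff_zero] at hint ⊢
  set c : Γ → ℝ := fun γ => inner ℝ (gradient (fun u => f u γ) w) z with hc
  have hcint : Integrable c 𝔻 := by
    have := hint.const_mul (d : ℝ)⁻¹
    simpa only [inv_mul_cancel_left₀ hd0] using this
  rw [integral_const_mul]
  congr 1
  set φ : ℝ → ℝ := fun t =>
    populationLoss f 𝔻 (w + t • z) - populationLoss f 𝔻 w - t * ∫ γ, c γ ∂𝔻 with hφ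
  have hφd : HasDerivAt φ (inner ℝ (gradient (populationLoss f 𝔻) w) z - ∫ γ, c γ ∂𝔻) 0 := by
    have h1 := hF.hasDerivAt_line w z 0
    rw [zero_smul, add_zero] at h1
    have := (h1.sub_const (populationLoss f 𝔻 w)).sub
      ((hasDerivAt_id (0 : ℝ)).mul_const (∫ γ, c γ ∂𝔻))
    rw [one_mul] at this
    exact this
  have hbound : ∀ t : ℝ, ‖φ t‖ ≤ (L / 2 * ‖z‖ ^ 2) * ‖‖t - 0‖ ^ 2‖ := by
    intro t
    have e : φ t = ∫ γ, (f (w + t • z) γ - f w γ - t * c γ) ∂𝔻 := by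
      have h1 : Integrable (fun γ => f (w + t • z) γ - f w γ) 𝔻 := (hf _).sub (hf _)
      rw [integral_sub h1 (hcint.const_mul t), integral_sub (hf _) (hf _), integral_const_mul]
      rfl
    rw [e]
    refine (norm_integral_le_of_norm_le_const (.of_forall fun γ => ?_)).trans_eq
      (by rw [probReal_univ, mul_one])
    have := (hs γ).abs_sub_sub_inner_le w (t • z)
    rw [inner_smul_right, norm_smul, mul_pow] at this
    rw [Real.norm_eq_abs, sub_zero, norm_pow, norm_norm]
    refine this.trans_eq (by ring)
  have h0 : HasDerivAt φ 0 0 := by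
    have h1 : φ =O[nhds 0] fun t : ℝ => ‖t - 0‖ ^ 2 :=
      Asymptotics.IsBigO.of_bound _ (.of_forall hbound)
    have := (h1.hasFDerivAt one_lt_two).hasDerivAt
    simpa using this
  have := hφd.unique h0
  linarith

theorem populationEstimate_eq (f : Vec d → Γ → ℝ) (𝔻 : Measure Γ) (w z : Vec d) :
    populationEstimate f 𝔻 0 w z = (∫ γ, zoCoeff (fun u => f u γ) 0 w z ∂𝔻) • z :=
  integral_smul_const _ z

/-- The average of the population estimates in `k` directions is the batch estimate of `∇F w`. -/
theorem average_populationEstimate [IsProbabilityMeasure 𝔻] (hf : ∀ w, Integrable (f w) 𝔻)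
    {L LF : ℝ≥0} (hs : ∀ γ, IsLSmooth L fun w => f w γ)
    (hF : IsLSmooth LF (populationLoss f 𝔻)) (hd : 1 ≤ d) {k : ℕ} {w : Vec d}
    (hint : ∀ z ∈ Metric.sphere (0 : Vec d) 1,
      Integrable (fun γ => zoCoeff (fun u => f u γ) 0 w z) 𝔻) (z : Fin k → UnitSphere d) :
    (1 / (k : ℝ)) • ∑ r, populationEstimate f 𝔻 0 w (z r) =
      batchEstimate (gradient (populationLoss f 𝔻) w) z := by
  simp only [populationEstimate_eq, batchEstimate, integral_zoCoeff hf hs hF hd (hint _ (z _).2)]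

end Population

/-! ### Uniform robustness -/

section Robust

variable {d m n k : ℕ} {Γ : Type*} {f : Vec d → Γ → ℝ}

/-- Robustness of the trimmed mean of the received messages, in terms of deviation sums over the
samples of each client and over the samples of all honest clients. -/
theorem abs_trimmedMean_messages_sub_le (hm : 1 ≤ m) (hn : 1 ≤ n) {β : ℝ} (hβ0 : 0 ≤ β)
    (hβ : β < 1 / 2) {B : Finset (Fin m)} (hB : (B.card : ℝ) ≤ β * m) {data : Fin m → Fin n → Γ}
    {w z : Vec d} {c t₁ t₂ : ℝ}
    (h₁ : ∀ i, |∑ j, (zoCoeff (fun u => f u (data i j)) 0 w z - c)| ≤ n * t₁)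
    (h₂ : |∑ p ∈ Bᶜ ×ˢ (Finset.univ : Finset (Fin n)),
      (zoCoeff (fun u => f u (data p.1 p.2)) 0 w z - c)| ≤ n * m * t₂) (byz : Fin m → ℝ) :
    |trimmedMean β (messages f 0 B data w z byz) - c| ≤ (t₂ + 3 * β * t₁) / (1 - 2 * β) := by
  have hn0 : (0 : ℝ) < n := by exact_mod_cast hn
  have hclient : ∀ i, clientCoeff f 0 (data i) w z - c =
      (1 / (n : ℝ)) * ∑ j, (zoCoeff (fun u => f u (data i j)) 0 w z - c) := by
    intro i
    simp only [clientCoeff, Finset.sum_sub_distrib, Finset.sum_const, Finset.card_univ,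
      Fintype.card_fin, nsmul_eq_mul]
    field_simp
  have hmsg : ∀ i ∉ B, messages f 0 B data w z byz i = clientCoeff f 0 (data i) w z :=
    fun i hi => if_neg hi
  refine abs_trimmedMean_sub_le hm hβ0 hβ hB ?_ ?_
  · intro i hi
    rw [hmsg i hi, hclient, abs_mul, abs_of_pos (by positivity), one_div_mul_eq_div,
      div_le_iff₀ hn0, mul_comm t₁]
    exact h₁ i
  · rw [Finset.sum_congr rfl fun i hi => by rw [hmsg i (Finset.mem_compl.1 hi), hclient],
      ← Finset.mul_sum, ← Finset.sum_product' Bᶜ Finset.univ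
        (fun i j => zoCoeff (fun u => f u (data i j)) 0 w z - c),
      abs_mul, abs_of_pos (by positivity), one_div_mul_eq_div, div_le_iff₀ hn0]
    linarith

variable [MeasurableSpace Γ] {𝔻 : Measure Γ}

theorem norm_robustEstimate_sub_le (hk : 1 ≤ k) {β R : ℝ} {B : Finset (Fin m)}
    {data : Fin m → Fin n → Γ} {w : Vec d} (z : Fin k → UnitSphere d) (byz : Fin k → Fin m → ℝ)
    (h : ∀ r, |trimmedMean β (messages f 0 B data w (z r) (byz r)) -
      ∫ γ, zoCoeff (fun u => f u γ) 0 w (z r) ∂𝔻| ≤ R) :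
    ‖robustEstimate f 0 β B data w z byz -
      (1 / (k : ℝ)) • ∑ r, populationEstimate f 𝔻 0 w (z r)‖ ≤ R := by
  have hk0 : (0 : ℝ) < k := by exact_mod_cast hk
  rw [robustEstimate, ← smul_sub, ← Finset.sum_sub_distrib, norm_smul, Real.norm_eq_abs,
    abs_of_pos (by positivity), one_div_mul_eq_div, div_le_iff₀ hk0]
  refine (norm_sum_le _ _).trans ((Finset.sum_le_card_nsmul _ _ R fun r _ => ?_).trans_eq ?_)
  · have hz : ‖(z r : Vec d)‖ = 1 := by simp
    rw [populationEstimate_eq, ← sub_smul, norm_smul, hz, mul_one]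
    exact h r
  · simp [mul_comm]

/-- Union bound over a finite family of sums of sub-exponential variables. The variables are only
almost everywhere measurable, so the good event is a measurable subset of the event of interest. -/
theorem exists_event_abs_sum_le {Ω ι κ : Type*} [MeasurableSpace Ω] {P : Measure Ω}
    [IsProbabilityMeasure P] {X : ι → Ω → Γ} {v : ℝ} (hv : 0 < v)
    (hXm : ∀ i, Measurable (X i)) (hX : iIndepFun X P) (hlaw : ∀ i, P.map (X i) = 𝔻)
    (I : Finset κ) {Y : κ → Γ → ℝ} (hY : ∀ c ∈ I, IsSubExponential v (Y c) 𝔻)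
    (S : κ → Finset ι) {N : κ → ℝ} (hN : ∀ c, 0 < N c) (hS : ∀ c, ((S c).card : ℝ) ≤ N c)
    {A : ℝ} (hA : 0 ≤ A) :
    ∃ G : Set Ω, MeasurableSet G ∧ 1 - I.card * (2 * Real.exp (-A)) ≤ P.real G ∧
      ∀ ω ∈ G, ∀ c ∈ I, |∑ i ∈ S c, (Y c (X i ω) - ∫ γ, Y c γ ∂𝔻)| ≤
        v * √(2 * N c * A) + 4 * v * A := by
  set bad : κ → Set Ω := fun c =>
    {ω | v * √(2 * N c * A) + 4 * v * A ≤ |∑ i ∈ S c, (Y c (X i ω) - ∫ γ, Y c γ ∂𝔻)|} with hbad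
  refine ⟨(toMeasurable P (⋃ c ∈ I, bad c))ᶜ, (measurableSet_toMeasurable _ _).compl, ?_, ?_⟩
  · rw [probReal_compl_eq_one_sub (measurableSet_toMeasurable _ _)]
    have h1 : P.real (toMeasurable P (⋃ c ∈ I, bad c)) = P.real (⋃ c ∈ I, bad c) := by
      rw [measureReal_def, measure_toMeasurable, measureReal_def]
    have h2 : P.real (⋃ c ∈ I, bad c) ≤ ∑ c ∈ I, P.real (bad c) :=
      measureReal_biUnion_finset_le I bad
    have h3 : ∑ c ∈ I, P.real (bad c) ≤ I.card * (2 * Real.exp (-A)) := by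
      rw [← nsmul_eq_mul]
      exact Finset.sum_le_card_nsmul _ _ _ fun c hc =>
        measureReal_abs_sum_ge_le hv (hY c hc) hXm hX hlaw (S c) (hN c) (hS c) hA
    linarith
  · intro ω hω c hc
    by_contra! hcon
    exact hω (subset_toMeasurable _ _ (Set.mem_biUnion hc hcon.le))

/-- Transfer of a deviation bound from `Y'` to a uniformly close `Y`. The error `e` enters twice:
through the sample values and through the mean. -/
theorem abs_sum_sub_integral_le [IsProbabilityMeasure 𝔻] {ι : Type*} (S : Finset ι) (x : ι → Γ)
    {Y Y' : Γ → ℝ} (hY : Integrable Y 𝔻) (hY' : Integrable Y' 𝔻) {e u : ℝ}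
    (he : ∀ γ, |Y γ - Y' γ| ≤ e) (h : |∑ i ∈ S, (Y' (x i) - ∫ γ, Y' γ ∂𝔻)| ≤ u) :
    |∑ i ∈ S, (Y (x i) - ∫ γ, Y γ ∂𝔻)| ≤ u + S.card * (2 * e) := by
  have hmean : |∫ γ, Y γ ∂𝔻 - ∫ γ, Y' γ ∂𝔻| ≤ e := by
    rw [← integral_sub hY hY', ← Real.norm_eq_abs]
    exact (norm_integral_le_of_norm_le_const (.of_forall he)).trans_eq
      (by rw [probReal_univ, mul_one])
  have hsplit : ∑ i ∈ S, (Y (x i) - ∫ γ, Y γ ∂𝔻) = ∑ i ∈ S, (Y' (x i) - ∫ γ, Y' γ ∂𝔻) +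
      ∑ i ∈ S, ((Y (x i) - Y' (x i)) - (∫ γ, Y γ ∂𝔻 - ∫ γ, Y' γ ∂𝔻)) := by
    rw [← Finset.sum_add_distrib]
    exact Finset.sum_congr rfl fun i _ => by ring
  rw [hsplit]
  refine (abs_add_le _ _).trans (add_le_add h ?_)
  rw [← nsmul_eq_mul]
  refine (Finset.abs_sum_le_sum_abs _ _).trans (Finset.sum_le_card_nsmul _ _ _ fun i _ => ?_)
  refine (abs_sub _ _).trans ?_
  linarith [he (x i)]

/-- The numerical comparison behind the radius `Δ`; `A = 2 d Λ + log m` is the exponent used in the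
union bound. -/
theorem radius_le_Delta (hd : 1 ≤ d) (hm : 1 ≤ m) (hn : 1 ≤ n) {v ε β L D : ℝ} (hv : 0 < v)
    (hε : 0 < ε) (hβ0 : 0 ≤ β) (hβ : β < 1 / 2 - ε) (hΛ : 0 ≤ logFactor m n L D) {A : ℝ}
    (hA : A = 2 * (d * logFactor m n L D) + Real.log m) :
    (((v * √(2 * (n * m) * A) + 4 * v * A) / (n * m) + 4 / (n * m)) +
      3 * β * ((v * √(2 * n * A) + 4 * v * A) / n + 4 / (n * m))) / (1 - 2 * β) ≤
      Delta 12 d m n v ε β L D := by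
  have hd0 : (0 : ℝ) < d := by exact_mod_cast hd
  have hn0 : (0 : ℝ) < n := by exact_mod_cast hn
  have hm1 : (1 : ℝ) ≤ m := by exact_mod_cast hm
  have hm0 : (0 : ℝ) < m := one_pos.trans_le hm1
  have hl : 0 ≤ Real.log m := Real.log_nonneg hm1
  rw [Delta]
  set Λ := logFactor m n L D
  set l := Real.log m
  set Q := √(Λ + 1 / d * l) * √d with hQ
  have hQ0 : 0 ≤ Q := by positivity
  have hA0 : 0 ≤ A := by rw [hA]; positivity
  have hA2 : A ≤ 2 * (d * Λ + l) := by rw [hA]; linarith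
  have hsq : √(2 * A) ≤ 2 * Q := by
    rw [Real.sqrt_le_left (by positivity), hQ, mul_pow, mul_pow, Real.sq_sqrt (by positivity),
      Real.sq_sqrt hd0.le]
    have : (2 : ℝ) ^ 2 * ((Λ + 1 / d * l) * d) = 4 * (d * Λ + l) := by field_simp; ring
    linarith
  have hroot : ∀ N : ℝ, 0 < N → √(2 * N * A) / N ≤ 2 * Q / √N := by
    intro N hN
    have e : √(2 * N * A) / N = √(2 * A) / √N := by
      rw [show 2 * N * A = 2 * A * N by ring, Real.sqrt_mul (by positivity)]
      rw [div_eq_div_iff hN.ne' (by positivity), mul_assoc, Real.mul_self_sqrt hN.le]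
    rw [e]
    gcongr
  have h1 := hroot n hn0
  have h2 := hroot (n * m) (by positivity)
  have hnum : ((v * √(2 * (n * m) * A) + 4 * v * A) / (n * m) + 4 / (n * m)) +
      3 * β * ((v * √(2 * n * A) + 4 * v * A) / n + 4 / (n * m)) ≤
      2 * (v * Q * (3 * β / √n + √2 / √(n * m)) +
        12 * (1 + v * (d * Λ + l)) * (β / n + 1 / (m * n))) := by
    have e1 : (v * √(2 * (n * m) * A) + 4 * v * A) / (n * m) ≤
        2 * v * Q * (√2 / √(n * m)) + 8 * (v * (d * Λ + l)) * (1 / (m * n)) := by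
      have s2 : (1 : ℝ) ≤ √2 := Real.one_le_sqrt.2 one_le_two
      calc _ = v * (√(2 * (n * m) * A) / (n * m)) + 4 * v * A * (1 / (m * n)) := by
            field_simp
        _ ≤ v * (2 * Q / √(n * m)) + 4 * v * (2 * (d * Λ + l)) * (1 / (m * n)) := by gcongr
        _ = 2 * v * Q * (1 / √(n * m)) + 8 * (v * (d * Λ + l)) * (1 / (m * n)) := by ring
        _ ≤ _ := by gcongr
    have e2 : (v * √(2 * n * A) + 4 * v * A) / n ≤
        2 * v * Q * (1 / √n) + 8 * (v * (d * Λ + l)) * (1 / n) := by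
      calc _ = v * (√(2 * n * A) / n) + 4 * v * A * (1 / n) := by field_simp
        _ ≤ v * (2 * Q / √n) + 4 * v * (2 * (d * Λ + l)) * (1 / n) := by gcongr
        _ = _ := by ring
    have e3 : 3 * β * ((v * √(2 * n * A) + 4 * v * A) / n) ≤
        3 * β * (2 * v * Q * (1 / √n) + 8 * (v * (d * Λ + l)) * (1 / n)) := by gcongr
    have e4 : (4 : ℝ) / (n * m) = 4 * (1 / (m * n)) := by field_simp
    have e5 : β * (4 / (n * m)) ≤ 4 * (β * (1 / n)) := by
      have : (1 : ℝ) / (n * m) ≤ 1 / n := by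
        gcongr
        nlinarith
      have := mul_le_mul_of_nonneg_left this hβ0
      calc β * (4 / (n * m)) = 4 * (β * (1 / (n * m))) := by ring
        _ ≤ _ := by linarith
    have p1 : 0 ≤ v * (d * Λ + l) * (1 / (m * n)) := by positivity
    have p2 : 0 ≤ v * (d * Λ + l) * (β * (1 / n)) := by positivity
    have p3 : 0 ≤ (1 : ℝ) / (m * n) := by positivity
    have p4 : 0 ≤ β * (1 / (n : ℝ)) := by positivity
    have e6 : β / (n : ℝ) = β * (1 / n) := by ring
    have e7 : 3 * β / √(n : ℝ) = 3 * β * (1 / √n) := by ring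
    rw [e6, e7]
    rw [e4] at e5 ⊢
    nlinarith
  rw [div_le_iff₀ (by linarith)]
  set Rhs := v * Q * (3 * β / √n + √2 / √(n * m)) +
        12 * (1 + v * (d * Λ + l)) * (β / n + 1 / (m * n)) with hR
  have hR0 : 0 ≤ Rhs := by positivity
  have e : √(Λ + 1 / d * l) * (v * √d / ε) * (3 * β / √n + √2 / √(n * m)) +
      12 / ε * (1 + v * (d * Λ + l)) * (β / n + 1 / (m * n)) = Rhs / ε := by
    rw [hR, hQ]; ring
  rw [e]
  refine hnum.trans ?_
  have : 2 * ε * (Rhs / ε) ≤ (1 - 2 * β) * (Rhs / ε) := by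
    have : 0 ≤ Rhs / ε := by positivity
    gcongr; linarith
  have e' : 2 * ε * (Rhs / ε) = 2 * Rhs := by field_simp
  linarith

/-- Uniform robustness with high probability: the concentration event on a product net of
`W × 𝕊`, whose size is at most `(1 + 2 n m L) ^ d * (1 + n m L D) ^ d`, extended to all of `W × 𝕊`
by the Lipschitz bounds. The mesh is of order `1 / (n m L)`, so that the discretization error is of
the order of the second summand of `Δ`. -/
theorem exists_event_robust (hd : 1 ≤ d) (hm : 1 ≤ m) (hn : 1 ≤ n) (hk : 1 ≤ k)
    [IsProbabilityMeasure 𝔻] {W : Set (Vec d)} (hc : IsCompact W) {Lw Lz : ℝ≥0}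
    (hLw : ∀ γ, ∀ z ∈ Metric.sphere (0 : Vec d) 1,
      LipschitzOnWith Lw (fun w => zoCoeff (fun u => f u γ) 0 w z) W)
    (hLz : ∀ γ, ∀ w ∈ W,
      LipschitzOnWith Lz (fun z => zoCoeff (fun u => f u γ) 0 w z) (Metric.sphere (0 : Vec d) 1))
    {v : ℝ} (hv : 0 < v)
    (hsub : ∀ w ∈ W, ∀ z ∈ Metric.sphere (0 : Vec d) 1,
      IsSubExponential v (fun γ => zoCoeff (fun u => f u γ) 0 w z) 𝔻)
    {B : Finset (Fin m)} {β ε : ℝ} (hB : (B.card : ℝ) ≤ β * m) (hε : 0 < ε) (hβ0 : 0 ≤ β)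
    (hβ : β < 1 / 2 - ε) {Ω : Type*} [MeasurableSpace Ω] {P : Measure Ω} [IsProbabilityMeasure P]
    {X : Fin m → Fin n → Ω → Γ} (hXm : ∀ i j, Measurable (X i j))
    (hX : iIndepFun (fun p : Fin m × Fin n => X p.1 p.2) P) (hlaw : ∀ i j, P.map (X i j) = 𝔻) :
    ∃ G : Set Ω, MeasurableSet G ∧
      1 - 4 / ((1 + 2 * n * m * ((Lw : ℝ) + Lz)) ^ d *
        (1 + n * m * ((Lw : ℝ) + Lz) * Metric.diam W) ^ d) ≤ P.real G ∧
      ∀ ω ∈ G, ∀ w ∈ W, ∀ (z : Fin k → UnitSphere d) (byz : Fin k → Fin m → ℝ),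
        ‖robustEstimate f 0 β B (fun i j => X i j ω) w z byz -
          (1 / (k : ℝ)) • ∑ r, populationEstimate f 𝔻 0 w (z r)‖ ≤
          Delta 12 d m n v ε β (Lw + Lz) (Metric.diam W) := by
  classical
  set L : ℝ := Lw + Lz with hL
  set D := Metric.diam W with hD
  have hD0 : 0 ≤ D := Metric.diam_nonneg
  have hd0 : (0 : ℝ) < d := by exact_mod_cast hd
  have hn0 : (0 : ℝ) < n := by exact_mod_cast hn
  have hm1 : (1 : ℝ) ≤ m := by exact_mod_cast hm
  have hm0 : (0 : ℝ) < m := one_pos.trans_le hm1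
  have hL0 : 0 ≤ L := by positivity
  rcases hL0.eq_or_lt with hLz0 | hLpos
  · -- for `L = 0` the probability bound is negative, and the empty event suffices
    refine ⟨∅, MeasurableSet.empty, ?_, by simp⟩
    rw [← hLz0]
    norm_num
  rcases W.eq_empty_or_nonempty with rfl | ⟨w₁, hw₁⟩
  · refine ⟨Set.univ, MeasurableSet.univ, ?_, by simp⟩
    rw [probReal_univ, sub_le_self_iff]
    positivity
  set Λ := logFactor m n L D with hΛ
  have hl1 : 0 ≤ Real.log (1 + n * m * L * D) := Real.log_nonneg (by
    have : 0 ≤ n * m * L * D := by positivity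
    linarith)
  have hl2 : 0 ≤ Real.log (1 + 2 * n * m * L) := Real.log_nonneg (by
    have : 0 ≤ 2 * n * m * L := by positivity
    linarith)
  have hΛ0 : 0 ≤ Λ := add_nonneg hl1 hl2
  set E := (1 + 2 * n * m * L) ^ d * (1 + n * m * L * D) ^ d with hE
  have hE0 : 0 < E := by positivity
  have hexp : Real.exp (d * Λ) = E := by
    rw [hΛ, logFactor, mul_add, Real.exp_add, Real.exp_nat_mul, Real.exp_nat_mul,
      Real.exp_log (by positivity), Real.exp_log (by positivity), hE, mul_comm]
  obtain ⟨s₁, hs₁W, hs₁c, hs₁⟩ := exists_net (A := W) (c := w₁) (R := D) (δ := 2 / (n * m * L))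
    (by positivity) hD0 fun x hx => Metric.dist_le_diam_of_mem hc.isBounded hx hw₁
  obtain ⟨s₂, hs₂S, hs₂c, hs₂⟩ := exists_net (A := Metric.sphere (0 : Vec d) 1) (c := 0) (R := 1)
    (δ := 1 / (n * m * L)) (by positivity) zero_le_one fun x hx => hx.le
  set A := 2 * (d * Λ) + Real.log m with hA
  have hA0 : 0 ≤ A := by
    have := Real.log_nonneg hm1
    positivity
  -- index `none`: all honest samples; index `some i`: the samples of client `i`
  let S : Option (Fin m) → Finset (Fin m × Fin n) := fun o =>
    o.elim (Bᶜ ×ˢ Finset.univ) fun i => {i} ×ˢ Finset.univ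
  let N : Option (Fin m) → ℝ := fun o => o.elim ((n : ℝ) * m) fun _ => n
  obtain ⟨G, hGm, hGP, hG⟩ := exists_event_abs_sum_le (𝔻 := 𝔻) hv (fun p => hXm p.1 p.2) hX
    (fun p => hlaw p.1 p.2) ((s₁ ×ˢ s₂) ×ˢ (Finset.univ : Finset (Option (Fin m))))
    (Y := fun c γ => zoCoeff (fun u => f u γ) 0 c.1.1 c.1.2)
    (fun c hc => by
      simp only [Finset.mem_product] at hc
      exact hsub _ (hs₁W _ hc.1.1) _ (hs₂S _ hc.1.2))
    (fun c => S c.2) (N := fun c => N c.2)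
    (by
      rintro ⟨_, _ | i⟩
      · exact mul_pos hn0 hm0
      · exact hn0)
    (by
      rintro ⟨_, _ | i⟩
      · simp only [S, N, Option.elim, Finset.card_product, Finset.card_univ, Fintype.card_fin,
          Nat.cast_mul]
        rw [mul_comm]
        gcongr
        simpa using Finset.card_le_univ Bᶜ
      · simp [S, N]) hA0
  refine ⟨G, hGm, le_trans ?_ hGP, ?_⟩
  · have hcard : (((s₁ ×ˢ s₂) ×ˢ (Finset.univ : Finset (Option (Fin m)))).card : ℝ) ≤
        E * (m + 1) := by
      simp only [Finset.card_product, Finset.card_univ, Fintype.card_option, Fintype.card_fin]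
      push_cast
      gcongr
      rw [hE, mul_comm]
      have e1 : 1 + 2 * D / (2 / (n * m * L)) = 1 + n * m * L * D := by field_simp
      have e2 : 1 + 2 * (1 : ℝ) / (1 / (n * m * L)) = 1 + 2 * n * m * L := by field_simp
      rw [e1] at hs₁c
      rw [e2] at hs₂c
      gcongr
    have hexpA : Real.exp (-A) = 1 / (E ^ 2 * m) := by
      rw [hA, Real.exp_neg, Real.exp_add, Real.exp_log hm0, two_mul, Real.exp_add, hexp, sq,
        one_div]
    rw [hexpA]
    have : (((s₁ ×ˢ s₂) ×ˢ (Finset.univ : Finset (Option (Fin m)))).card : ℝ) *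
        (2 * (1 / (E ^ 2 * m))) ≤ E * (m + 1) * (2 * (1 / (E ^ 2 * m))) := by gcongr
    have h2 : E * (m + 1) * (2 * (1 / (E ^ 2 * m))) ≤ 4 / E := by
      have : E * (m + 1) * (2 * (1 / (E ^ 2 * m))) = 2 * (m + 1) / m / E := by field_simp
      rw [this]
      gcongr
      rw [div_le_iff₀ hm0]
      linarith
    linarith
  intro ω hω w hw z byz
  refine norm_robustEstimate_sub_le hk z byz fun r => ?_
  obtain ⟨w', hw', hww'⟩ := hs₁ w hw
  obtain ⟨z', hz', hzz'⟩ := hs₂ (z r) (z r).2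
  have hY := hsub w hw (z r) (z r).2
  have hY' := hsub w' (hs₁W _ hw') z' (hs₂S _ hz')
  have hlip : ∀ γ, |zoCoeff (fun u => f u γ) 0 w (z r) - zoCoeff (fun u => f u γ) 0 w' z'| ≤
      2 / (n * m) := by
    intro γ
    have h1 := (hLw γ (z r) (z r).2).dist_le_mul w hw w' (hs₁W _ hw')
    have h2 := (hLz γ w' (hs₁W _ hw')).dist_le_mul (z r) (z r).2 z' (hs₂S _ hz')
    rw [← Real.dist_eq]
    refine (dist_triangle _ (zoCoeff (fun u => f u γ) 0 w' (z r)) _).trans ?_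
    have h3 : (Lw : ℝ) * dist w w' ≤ Lw * (2 / (n * m * L)) := by gcongr
    have h4 : (Lz : ℝ) * dist (z r : Vec d) z' ≤ Lz * (2 / (n * m * L)) := by
      gcongr
      refine hzz'.trans ?_
      gcongr
      norm_num
    have h5 : (Lw : ℝ) * (2 / (n * m * L)) + Lz * (2 / (n * m * L)) = 2 / (n * m) := by
      rw [← add_mul, ← hL]
      field_simp
    linarith
  have hnet : ∀ o, |∑ p ∈ S o, (zoCoeff (fun u => f u (X p.1 p.2 ω)) 0 w (z r) -
      ∫ γ, zoCoeff (fun u => f u γ) 0 w (z r) ∂𝔻)| ≤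
      v * √(2 * N o * A) + 4 * v * A + (S o).card * (2 * (2 / (n * m))) := fun o =>
    abs_sum_sub_integral_le (S o) (fun p => X p.1 p.2 ω) hY.1 hY'.1 hlip
      (hG ω hω ((w', z'), o) (by simp [hw', hz']))
  refine (abs_trimmedMean_messages_sub_le hm hn hβ0 (by linarith) hB
    (t₁ := (v * √(2 * n * A) + 4 * v * A) / n + 4 / (n * m))
    (t₂ := (v * √(2 * (n * m) * A) + 4 * v * A) / (n * m) + 4 / (n * m)) ?_ ?_ (byz r)).trans
    (radius_le_Delta hd hm hn hv hε hβ0 hβ hΛ0 hA)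
  · intro i
    have h := hnet (some i)
    simp only [S, N, Option.elim, Finset.sum_product, Finset.sum_singleton, Finset.card_product,
      Finset.card_singleton, Finset.card_univ, Fintype.card_fin, one_mul] at h
    refine h.trans_eq ?_
    field_simp
    ring
  · refine (hnet none).trans ?_
    have hcard : ((S none).card : ℝ) ≤ n * m := by
      simp only [S, Option.elim, Finset.card_product, Finset.card_univ, Fintype.card_fin,
        Nat.cast_mul]
      rw [mul_comm]
      gcongr
      simpa using Finset.card_le_univ Bᶜ
    calc v * √(2 * N none * A) + 4 * v * A + (S none).card * (2 * (2 / (n * m)))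
        ≤ v * √(2 * (n * m) * A) + 4 * v * A + n * m * (2 * (2 / (n * m))) := by
          simp only [N, Option.elim]
          gcongr
      _ = _ := by field_simp; ring

end Robust

/-! ### Convergence of the iterates -/

section Iterates

variable {d m n k : ℕ} {Γ : Type*} {f : Vec d → Γ → ℝ} {W : Set (Vec d)} {β η : ℝ}
  {B : Finset (Fin m)} {data : Fin m → Fin n → Γ} {A : Attack d k m} {w₀ : Vec d}

theorem iterate_mem (hc : IsCompact W) (hw₀ : w₀ ∈ W) (ζ : ℕ → Fin k → UnitSphere d) :
    ∀ t, iterate f W 0 β η B data A w₀ ζ t ∈ W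
  | 0 => hw₀
  | _ + 1 => (euclProj_spec hc ⟨w₀, hw₀⟩ _).1

/-- The iterate of step `t` depends only on the directions of the earlier steps. -/
theorem iterate_congr {ζ ζ' : ℕ → Fin k → UnitSphere d} {t : ℕ} (h : ∀ s < t, ζ s = ζ' s) :
    iterate f W 0 β η B data A w₀ ζ t = iterate f W 0 β η B data A w₀ ζ' t := by
  induction t with
  | zero => rfl
  | succ t ih =>
    have h1 := ih fun s hs => h s (by omega)
    have h2 := h t (by omega)
    have h3 : (fun s : Fin (t + 1) => ζ s) = fun s : Fin (t + 1) => ζ' s :=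
      funext fun s => h s s.2
    simp only [iterate, h1, h2, h3]

theorem measurable_robustEstimate {L : ℝ≥0} (hs : ∀ γ, IsLSmooth L fun w => f w γ)
    {Ω : Type*} [MeasurableSpace Ω] {w : Ω → Vec d} {z : Ω → Fin k → UnitSphere d}
    {byz : Ω → Fin k → Fin m → ℝ} (hw : Measurable w) (hz : Measurable z) (hb : Measurable byz) :
    Measurable fun ω => robustEstimate f 0 β B data (w ω) (z ω) (byz ω) := by
  have hzr : ∀ r, Measurable fun ω => (z ω r : Vec d) := fun r =>
    measurable_subtype_coe.comp ((measurable_pi_apply r).comp hz)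
  have hmsg : ∀ r i, Measurable fun ω => messages f 0 B data (w ω) (z ω r) (byz ω r) i := by
    intro r i
    by_cases hi : i ∈ B
    · simp only [messages, hi, if_true]
      exact (measurable_pi_apply i).comp ((measurable_pi_apply r).comp hb)
    · simp only [messages, hi, if_false, clientCoeff, zoCoeff_zero]
      refine (Finset.measurable_fun_sum _ fun j _ => ?_).const_mul _
      refine Measurable.const_mul (Measurable.inner ?_ (hzr r)) _
      exact (hs (data i j)).2.continuous.measurable.comp hw
  have htrim : ∀ r, Measurable fun ω =>
      trimmedMean β (messages f 0 B data (w ω) (z ω r) (byz ω r)) := fun r =>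
    (measurable_trimmedMean β).comp (measurable_pi_lambda _ (hmsg r))
  have hsum : Measurable fun ω => ∑ r,
      trimmedMean β (messages f 0 B data (w ω) (z ω r) (byz ω r)) • (z ω r : Vec d) :=
    Finset.measurable_fun_sum _ fun r _ => (htrim r).smul (hzr r)
  exact hsum.const_smul (1 / (k : ℝ))

theorem measurable_iterate {L : ℝ≥0} (hs : ∀ γ, IsLSmooth L fun w => f w γ) (hW : Convex ℝ W)
    (hc : IsCompact W) (hw₀ : w₀ ∈ W) (hA : ∀ t, Measurable (A t)) (t : ℕ) :
    Measurable fun ζ => iterate f W 0 β η B data A w₀ ζ t := by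
  induction t with
  | zero => exact measurable_const
  | succ t ih =>
    refine (continuous_euclProj hW hc ⟨w₀, hw₀⟩).measurable.comp
      (ih.sub (Measurable.const_smul ?_ η))
    refine measurable_robustEstimate hs ih (measurable_pi_apply t) ((hA t).comp ?_)
    exact measurable_pi_lambda _ fun s => measurable_pi_apply _

theorem isProbabilityMeasure_directionLaw (hd : 1 ≤ d) (k : ℕ) :
    IsProbabilityMeasure (directionLaw d k) := by
  have := isProbabilityMeasure_uniformSphere hd
  unfold directionLaw
  infer_instance

/-- A function of the directions before step `t` is independent of those of step `t`, so the latter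
can be integrated out first. -/
theorem integral_directionLaw_step (hd : 1 ≤ d) {t : ℕ}
    {w : (ℕ → Fin k → UnitSphere d) → Vec d} (hw : Measurable w)
    (hdep : ∀ ζ ζ', (∀ s < t, ζ s = ζ' s) → w ζ = w ζ')
    {Ψ : Vec d → (Fin k → UnitSphere d) → ℝ} (hΨ : Measurable (Function.uncurry Ψ))
    (hint : Integrable (fun ζ => Ψ (w ζ) (ζ t)) (directionLaw d k)) :
    Integrable (fun ζ => ∫ z, Ψ (w ζ) z ∂(batchLaw d k)) (directionLaw d k) ∧
    ∫ ζ, Ψ (w ζ) (ζ t) ∂(directionLaw d k) =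
      ∫ ζ, ∫ z, Ψ (w ζ) z ∂(batchLaw d k) ∂(directionLaw d k) := by
  have := isProbabilityMeasure_uniformSphere hd
  have := isProbabilityMeasure_directionLaw hd k
  obtain ⟨z₀⟩ : Nonempty (Fin k → UnitSphere d) := nonempty_of_isProbabilityMeasure (batchLaw d k)
  have hev : Measurable fun ζ : ℕ → Fin k → UnitSphere d => ζ t := measurable_pi_apply t
  have hind : IndepFun w (fun ζ => ζ t) (directionLaw d k) := by
    have h : iIndepFun (fun (s : ℕ) (ζ : ℕ → Fin k → UnitSphere d) => ζ s) (directionLaw d k) :=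
      iIndepFun_infinitePi (P := fun _ : ℕ => batchLaw d k) (X := fun _ z => z)
        fun _ => measurable_id
    have h2 := h.indepFun_finset (Finset.range t) {t} (by simp) fun s => measurable_pi_apply s
    -- `w` factors through the restriction to the first `t` steps
    let ext : (Finset.range t → Fin k → UnitSphere d) → ℕ → Fin k → UnitSphere d :=
      fun p s => if hs : s ∈ Finset.range t then p ⟨s, hs⟩ else z₀
    have hext : Measurable ext := by
      refine measurable_pi_lambda _ fun s => ?_
      by_cases hs : s ∈ Finset.range t
      · simp only [ext, hs, dite_true]
        exact measurable_pi_apply _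
      · simp only [ext, hs, dite_false]
        exact measurable_const
    have h3 := h2.comp (hw.comp hext)
      (measurable_pi_apply (⟨t, Finset.mem_singleton_self t⟩ : ({t} : Finset ℕ)))
    have e : w = (w ∘ ext) ∘ fun ζ (s : Finset.range t) => ζ s := by
      ext1 ζ
      refine hdep _ _ fun s hs => ?_
      simp [ext, hs]
    rw [e]
    exact h3
  have hmap : (directionLaw d k).map (fun ζ => (w ζ, ζ t)) =
      ((directionLaw d k).map w).prod (batchLaw d k) := by
    rw [(indepFun_iff_map_prod_eq_prod_map_map hw.aemeasurable hev.aemeasurable).1 hind]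
    congr 1
    exact (measurePreserving_eval_infinitePi (fun _ : ℕ => batchLaw d k) t).map_eq
  have hpair : Measurable fun ζ : ℕ → Fin k → UnitSphere d => (w ζ, ζ t) := hw.prodMk hev
  have hint' : Integrable (Function.uncurry Ψ)
      (((directionLaw d k).map w).prod (batchLaw d k)) := by
    rw [← hmap, integrable_map_measure hΨ.aestronglyMeasurable hpair.aemeasurable]
    exact hint
  have := Measure.isProbabilityMeasure_map (μ := directionLaw d k) hw.aemeasurable
  constructor
  · exact hint'.integral_prod_left.comp_measurable hw
  · calc ∫ ζ, Ψ (w ζ) (ζ t) ∂(directionLaw d k)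
        = ∫ p, Function.uncurry Ψ p ∂((directionLaw d k).map fun ζ => (w ζ, ζ t)) :=
          (integral_map hpair.aemeasurable hΨ.aestronglyMeasurable).symm
      _ = ∫ x, ∫ z, Ψ x z ∂(batchLaw d k) ∂((directionLaw d k).map w) := by
          rw [hmap, integral_prod _ hint']
          rfl
      _ = _ := integral_map hw.aemeasurable hint'.integral_prod_left.aestronglyMeasurable

theorem norm_batchEstimate_le (hk : 1 ≤ k) (g : Vec d) (z : Fin k → UnitSphere d) :
    ‖batchEstimate g z‖ ≤ d * ‖g‖ := by
  have hk0 : (0 : ℝ) < k := by exact_mod_cast hk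
  rw [batchEstimate, norm_smul, Real.norm_eq_abs, abs_of_pos (by positivity), one_div_mul_eq_div,
    div_le_iff₀ hk0]
  refine (norm_sum_le _ _).trans
    ((Finset.sum_le_card_nsmul _ _ (d * ‖g‖) fun r _ => ?_).trans_eq ?_)
  · have hz : ‖(z r : Vec d)‖ = 1 := by simp
    rw [norm_smul, hz, mul_one, norm_mul, Real.norm_natCast]
    gcongr
    have := norm_inner_le_norm (𝕜 := ℝ) g (z r : Vec d)
    rwa [hz, mul_one] at this
  · simp [mul_comm]

/-- Convergence of the iterates up to the radius `R` of the gradient estimate: every step contracts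
the expected distance to the optimum by `1 - lam / (τ (LF + lam))` and adds at most `η R`. -/
theorem integral_norm_iterate_sub_le (hd : 1 ≤ d) (hk : 1 ≤ k) {L LF : ℝ≥0}
    (hs : ∀ γ, IsLSmooth L fun w => f w γ) {F : Vec d → ℝ} (hF : IsLSmooth LF F)
    {lam : ℝ} (hlam : 0 < lam) (hconv : StrongConvexOn Set.univ lam F) (hW : Convex ℝ W)
    (hc : IsCompact W) {wStar : Vec d} (hwS : wStar ∈ W) (hmin : IsLocalMin F wStar)
    {τ R : ℝ} (hτ : τ = ((d : ℝ) + k - 1) / k) (hη : η = 1 / (τ * LF))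
    (hrob : ∀ w ∈ W, ∀ (z : Fin k → UnitSphere d) (byz : Fin k → Fin m → ℝ),
      ‖robustEstimate f 0 β B data w z byz - batchEstimate (gradient F w) z‖ ≤ R)
    (hA : ∀ t, Measurable (A t)) (hw₀ : w₀ ∈ W) (T : ℕ) :
    Integrable (fun ζ => ‖iterate f W 0 β η B data A w₀ ζ T - wStar‖) (directionLaw d k) ∧
      ∫ ζ, ‖iterate f W 0 β η B data A w₀ ζ T - wStar‖ ∂(directionLaw d k) ≤
        (1 - lam / (τ * (LF + lam))) ^ T * ‖w₀ - wStar‖ + 2 / lam * R := by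
  have := isProbabilityMeasure_uniformSphere hd
  have := isProbabilityMeasure_directionLaw hd k
  have hL := hF.le_of_strongConvexOn hconv hd
  have hL0 : (0 : ℝ) < LF := hlam.trans_le hL
  have hd1 : (1 : ℝ) ≤ d := by exact_mod_cast hd
  have hk1 : (1 : ℝ) ≤ k := by exact_mod_cast hk
  have hτ1 : 1 ≤ τ := by rw [hτ, le_div_iff₀ (by positivity)]; linarith
  have hτ0 : 0 < τ := one_pos.trans_le hτ1
  have hη0 : 0 < η := by rw [hη]; positivity
  have hgS : gradient F wStar = 0 := by rw [gradient, hmin.fderiv_eq_zero, map_zero]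
  have hR : 0 ≤ R := by
    obtain ⟨z₀⟩ : Nonempty (Fin k → UnitSphere d) :=
      nonempty_of_isProbabilityMeasure (batchLaw d k)
    exact (norm_nonneg _).trans (hrob wStar hwS z₀ 0)
  set p := lam / (τ * (LF + lam)) with hp
  have hp1 : p ≤ 1 := by
    rw [hp, div_le_one (by positivity)]
    nlinarith
  set x : ℕ → (ℕ → Fin k → UnitSphere d) → Vec d :=
    fun t ζ => iterate f W 0 β η B data A w₀ ζ t with hx
  have hxm : ∀ t, Measurable (x t) := measurable_iterate hs hW hc hw₀ hA
  have hxW : ∀ t ζ, x t ζ ∈ W := fun t ζ => iterate_mem hc hw₀ ζ t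
  have hdist : ∀ t ζ, ‖x t ζ - wStar‖ ≤ Metric.diam W := fun t ζ => by
    rw [← dist_eq_norm]
    exact Metric.dist_le_diam_of_mem hc.isBounded (hxW t ζ) hwS
  have hint : ∀ t, Integrable (fun ζ => ‖x t ζ - wStar‖) (directionLaw d k) := fun t =>
    Integrable.of_bound ((hxm t).sub_const _).norm.aestronglyMeasurable (Metric.diam W)
      (.of_forall fun ζ => by rw [norm_norm]; exact hdist t ζ)
  refine ⟨hint T, ?_⟩
  -- one step of the exact method, as a function of the current iterate and the directions
  set Ψ : Vec d → (Fin k → UnitSphere d) → ℝ :=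
    fun w z => ‖(w - wStar) - η • batchEstimate (gradient F w) z‖ with hΨ
  have hgc : Continuous (gradient F) := hF.2.continuous
  have hΨm : Measurable (Function.uncurry Ψ) := by
    have : Continuous (Function.uncurry Ψ) := by
      simp only [hΨ, batchEstimate, Function.uncurry_def]
      fun_prop
    exact this.measurable
  have hgrad : ∀ w, ‖gradient F w‖ ≤ LF * ‖w - wStar‖ := fun w => by
    simpa [hgS] using hF.norm_gradient_sub_le w wStar
  have hΨint : ∀ t, Integrable (fun ζ => Ψ (x t ζ) (ζ t)) (directionLaw d k) := by
    intro t
    refine Integrable.of_bound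
      (hΨm.comp ((hxm t).prodMk (measurable_pi_apply t))).aestronglyMeasurable
      (Metric.diam W + η * (d * (LF * Metric.diam W))) (.of_forall fun ζ => ?_)
    simp only [hΨ, norm_norm]
    refine (norm_sub_le _ _).trans (add_le_add (hdist t ζ) ?_)
    rw [norm_smul, Real.norm_eq_abs, abs_of_pos hη0]
    gcongr
    refine (norm_batchEstimate_le hk _ _).trans ?_
    gcongr
    exact (hgrad _).trans (by gcongr; exact hdist t ζ)
  have hexact : ∀ t, ∫ ζ, Ψ (x t ζ) (ζ t) ∂(directionLaw d k) ≤
      (1 - p) * ∫ ζ, ‖x t ζ - wStar‖ ∂(directionLaw d k) := by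
    intro t
    obtain ⟨h1, h2⟩ := integral_directionLaw_step hd (hxm t)
      (fun ζ ζ' h => iterate_congr h) hΨm (hΨint t)
    rw [h2, ← integral_const_mul]
    refine integral_mono h1 ((hint t).const_mul _) fun ζ => ?_
    refine integral_norm_sub_batchEstimate_le hd hk hlam hL hτ hη ?_
    have := hF.interpolation hL hconv (x t ζ) wStar
    rwa [hgS, sub_zero] at this
  have hstep : ∀ t, ∫ ζ, ‖x (t + 1) ζ - wStar‖ ∂(directionLaw d k) ≤
      (1 - p) * ∫ ζ, ‖x t ζ - wStar‖ ∂(directionLaw d k) + η * R := by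
    intro t
    have hpt : ∀ ζ, ‖x (t + 1) ζ - wStar‖ ≤ Ψ (x t ζ) (ζ t) + η * R := by
      intro ζ
      have e : x (t + 1) ζ = euclProj W (x t ζ -
        η • robustEstimate f 0 β B data (x t ζ) (ζ t) (A t fun s => ζ s)) := rfl
      rw [e]
      nth_rw 1 [← euclProj_of_mem hc hwS]
      refine (norm_euclProj_sub_euclProj_le hW hc ⟨w₀, hw₀⟩ _ _).trans ?_
      set ĝ := robustEstimate f 0 β B data (x t ζ) (ζ t) (A t fun s => ζ s)
      have e2 : x t ζ - η • ĝ - wStar =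
          (x t ζ - wStar - η • batchEstimate (gradient F (x t ζ)) (ζ t)) -
            η • (ĝ - batchEstimate (gradient F (x t ζ)) (ζ t)) := by
        rw [smul_sub]; abel
      rw [e2]
      refine (norm_sub_le _ _).trans (add_le_add le_rfl ?_)
      rw [norm_smul, Real.norm_eq_abs, abs_of_pos hη0]
      gcongr
      exact hrob _ (hxW t ζ) _ _
    calc _ ≤ ∫ ζ, (Ψ (x t ζ) (ζ t) + η * R) ∂(directionLaw d k) :=
          integral_mono (hint _) ((hΨint t).add (integrable_const _)) hpt
      _ = ∫ ζ, Ψ (x t ζ) (ζ t) ∂(directionLaw d k) + η * R := by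
          rw [integral_add (hΨint t) (integrable_const _), integral_const, probReal_univ, one_smul]
      _ ≤ _ := by linarith [hexact t]
  -- `2 R / lam` dominates the fixed point of `a ↦ (1 - p) a + η R`, because `lam ≤ LF`
  have hfix : η * R ≤ p * (2 / lam * R) := by
    have e : p * (2 / lam * R) = 2 / (τ * (LF + lam)) * R := by rw [hp]; field_simp
    rw [e, hη]
    refine mul_le_mul_of_nonneg_right ?_ hR
    rw [div_le_div_iff₀ (by positivity) (by positivity)]
    nlinarith
  induction T with
  | zero =>
    have : 0 ≤ 2 / lam * R := by positivity
    simp only [iterate, integral_const, probReal_univ, one_smul, pow_zero, one_mul]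
    linarith
  | succ T ih =>
    have h1 := mul_le_mul_of_nonneg_left ih (sub_nonneg.2 hp1)
    have h2 := hstep T
    rw [pow_succ]
    linarith

end Iterates

end CyBeR0

open CyBeR0
theorem mainTheorem2 :
    ∃ C : ℝ, 0 < C ∧
    ∀ (d m n k : ℕ) (_ : 1 ≤ d) (_ : 1 ≤ m) (_ : 1 ≤ n) (_ : 1 ≤ k)
      -- data space, data distribution, loss
      (Γ : Type*) [MeasurableSpace Γ] (𝔻 : Measure Γ) [IsProbabilityMeasure 𝔻]
      (f : Vec d → Γ → ℝ) (_ : ∀ w, Integrable (f w) 𝔻)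
      -- parameter space
      (W : Set (Vec d)) (_ : Convex ℝ W) (_ : IsCompact W)
      -- smoothness
      (L LF Lw Lz : ℝ≥0) (_ : ∀ γ, IsLSmooth L fun w => f w γ)
      (_ : IsLSmooth LF (populationLoss f 𝔻))
      (_ : ∀ γ, ∀ z ∈ Metric.sphere (0 : Vec d) 1,
        LipschitzOnWith Lw (fun w => zoCoeff (fun u => f u γ) 0 w z) W)
      (_ : ∀ γ, ∀ w ∈ W,
        LipschitzOnWith Lz (fun z => zoCoeff (fun u => f u γ) 0 w z) (Metric.sphere (0 : Vec d) 1))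
      -- sub-exponentiality
      (v : ℝ) (_ : 0 < v)
      (_ : ∀ w ∈ W, ∀ z ∈ Metric.sphere (0 : Vec d) 1,
        IsSubExponential v (fun γ => zoCoeff (fun u => f u γ) 0 w z) 𝔻)
      -- strong convexity
      (lam : ℝ) (_ : 0 < lam) (_ : StrongConvexOn Set.univ lam (populationLoss f 𝔻))
      -- the optimum
      (wStar : Vec d) (_ : wStar ∈ W) (_ : IsMinOn (populationLoss f 𝔻) W wStar)
      (_ : IsLocalMin (populationLoss f 𝔻) wStar)
      -- Byzantine clients, trimming
      (B : Finset (Fin m)) (α β ε : ℝ) (_ : (B.card : ℝ) = α * m) (_ : 0 < ε) (_ : α ≤ β)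
      (_ : β < 1 / 2 - ε)
      -- i.i.d. data samples: `X i j` is the sample with index `j` of client `i`
      (Ω : Type*) [MeasurableSpace Ω] (P : Measure Ω) [IsProbabilityMeasure P]
      (X : Fin m → Fin n → Ω → Γ) (_ : ∀ i j, Measurable (X i j))
      (_ : iIndepFun (fun p : Fin m × Fin n => X p.1 p.2) P)
      (_ : ∀ i j, P.map (X i j) = 𝔻)
      -- parameters of the algorithm
      (τ η : ℝ) (_ : τ = ((d : ℝ) + k - 1) / k) (_ : η = 1 / (τ * LF)),
      ∃ G : Set Ω, MeasurableSet G ∧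
        1 - 4 / ((1 + 2 * n * m * ((Lw : ℝ) + Lz)) ^ d *
          (1 + n * m * ((Lw : ℝ) + Lz) * Metric.diam W) ^ d) ≤ P.real G ∧
        ∀ ω ∈ G,
          -- uniform robustness bound for the gradient estimate
          (∀ w ∈ W, ∀ (z : Fin k → UnitSphere d) (byz : Fin k → Fin m → ℝ),
            ‖robustEstimate f 0 β B (fun i j => X i j ω) w z byz -
              (1 / (k : ℝ)) • ∑ r, populationEstimate f 𝔻 0 w (z r)‖ ≤
              Delta C d m n v ε β (Lw + Lz) (Metric.diam W)) ∧
          -- convergence, against every Byzantine strategy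
          (∀ (A : Attack d k m) (_ : ∀ t, Measurable (A t)), ∀ w₀ ∈ W, ∀ T : ℕ,
            Integrable (fun ζ =>
              ‖iterate f W 0 β η B (fun i j => X i j ω) A w₀ ζ T - wStar‖) (directionLaw d k) ∧
            ∫ ζ, ‖iterate f W 0 β η B (fun i j => X i j ω) A w₀ ζ T - wStar‖ ∂(directionLaw d k) ≤
              (1 - lam / (τ * (LF + lam))) ^ T * ‖w₀ - wStar‖ +
                2 / lam * Delta C d m n v ε β (Lw + Lz) (Metric.diam W)) := by
  refine ⟨12, by norm_num, ?_⟩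
  intro d m n k hd hm hn hk Γ _ 𝔻 _ f hf W hW hc L LF Lw Lz hs hF hLw hLz v hv hsub lam hlam hconv
    wStar hwS _ hmin B α β ε hB hε hαβ hβ Ω _ P _ X hXm hX hlaw τ η hτ hη
  have hm0 : (0 : ℝ) < m := by exact_mod_cast hm
  have hBβ : (B.card : ℝ) ≤ β * m := hB.trans_le (by gcongr)
  have hβ0 : 0 ≤ β := nonneg_of_mul_nonneg_left ((Nat.cast_nonneg _).trans hBβ) hm0
  obtain ⟨G, hGm, hGP, hG⟩ := exists_event_robust (k := k) hd hm hn hk hc hLw hLz hv hsub hBβ hε hβ0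
    hβ hXm hX hlaw
  refine ⟨G, hGm, hGP, fun ω hω => ⟨hG ω hω, fun A hA w₀ hw₀ T => ?_⟩⟩
  refine integral_norm_iterate_sub_le hd hk hs hF hlam hconv hW hc hwS hmin hτ hη ?_ hA hw₀ T
  intro w hw z byz
  rw [← average_populationEstimate hf hs hF hd (fun z hz => (hsub w hw z hz).1)]
  exact hG ω hω w hw z byz
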